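/- Let $d\ge 1$ and $k\ge -1$ be integers, let $\mathbb V$ be a separable complex Hilbert space with inner product $\langle\cdot,\cdot\rangle$ linear in its first argument, and write $(f\otimes g)h=\langle h,g\rangle f$. Let $\mathbb T$ be the space of trace-class operators on $\mathbb V$ and $\mathbb T_+$ the set of positive ones; a finite $\mathbb T_+$-valued measure is a countably additive $\mathbb T_+$-valued set function on a $\sigma$-field. Let $\Lambda_k$ be the space of finitely supported complex measures $\lambda$ on $\mathbb R^d$ that annihilate all polynomials of degree at most $k$ ($\Lambda_{-1}$ is the space of all finitely supported complex measures). An *IRF$_k$* is a process $Y=\{Y(\lambda)\}_{\lambda\in\Lambda_k}$ of $\mathbb V$-valued random elements, linear in $\lambda$, with $\mathbb E\|Y(\lambda)\|^2<\infty$ and $\mathbb EY(\lambda)=0$, whose covariance $\mathcal C_Y(\lambda,\mu)=\mathbb E[Y(\lambda)\otimes Y(\mu)]$ is invariant under simultaneous translation of $\lambda$ and $\mu$. It is *$L^2$-continuous* if $Y(\lambda)=\int \breve Y\,d\lambda$ ($\lambda\in\Lambda_k$) for some square-integrable, mean-square continuous random field $\breve Y$ on $\mathbb R^d$. For a bounded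 operator $\mathcal H$ put $c^{\mathcal H}=\exp(\log(c)\,\mathcal H)$; $Y$ is *covariance $\mathcal H$-self-similar* if for every $c>0$ the processes $\{Y(c\cdot\lambda)\}$ and $\{c^{\mathcal H}Y(\lambda)\}$ have the same covariance, where $c\cdot\lambda=\lambda(c^{-1}\,\cdot)$. $Y$ has *spectral characteristics* $(\chi,\mathcal Q)$, and $\chi$ is its *spectral measure*, if $\chi$ is a finite $\mathbb T_+$-valued Borel measure on $\mathbb R^d$ with $\chi(\{0\})=0$, $\mathcal Q$ is a conditionally positive definite (of degree $k$) polynomial on $\mathbb R^d$ with coefficients in $\mathbb T$, of degree at most $2k+2$, and, for a bounded Borel neighbourhood $B$ of $0$ (the choice of which is immaterial), the function $$\mathcal K(h)=\int_{\mathbb R^d}\frac{e^{i u^\top h}-1_B(u)\sum_{j=0}^{2k+1}(iu^\top h)^j/j!}{1\wedge\|u\|^{2k+2}}\,\chi(du)+\mathcal Q(h)$$ satisfies $\mathcal C_Y(\lambda,\mu)=\sum_{j,j'}c_j\overline{d_{j'}}\,\mathcal K(t_j-s_{j'})$ for all $\lambda=\sum_jc_j\delta_{t_j}$ and $\mu=\sum_{j'}d_{j'}\delta_{s_{j'}}$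 in $\Lambda_k$. Here $\mathcal Q$ is conditionally positive definite of degree $k$ if $\sum_{j,j'}c_j\overline{c_{j'}}\,\mathcal Q(t_j-t_{j'})\ge0$ for all $\sum_jc_j\delta_{t_j}\in\Lambda_k$. **Theorem.** Let $\mathcal H=\sum_j\lambda_j\,e_j\otimes e_j$ (convergence in the weak operator topology) be a bounded normal operator on $\mathbb V$, where $\lambda_j\in\mathbb C$ and $\{e_j\}$ is a complete orthonormal system of $\mathbb V$ (eigenvalues $\lambda_j=0$ are allowed). Let $\sigma$ be a finite $\mathbb T_+$-valued Borel measure on the unit sphere $\mathbb S$ of $\mathbb R^d$. The following are equivalent. 1. The formula $\chi(dr\,d\theta)=(1\wedge r^{2k+2})\,r^{-\mathcal H}\sigma(d\theta)\,r^{-\mathcal H^*}\,r^{-1}dr$ defines the spectral measure of an $L^2$-continuous covariance $\mathcal H$-self-similar IRF$_k$. That is, there is such a process whose spectral measure $\chi$ satisfies, for all Borel sets $D\subset\mathbb R^d$ bounded away from $0$, $$\chi(D)=\int_0^\infty(1\wedge r^{2k+2})\,r^{-\mathcal H}\,\sigma(\{\theta\in\mathbb S: r\theta\in D\})\,r^{-\mathcal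 H^*}\,\frac{dr}{r}$$ as a Bochner integral in $\mathbb T$ with the trace norm. 2. Statement 1 holds with a process whose spectral characteristics are $(\chi,0)$, i.e. with trivial polynomial component. 3. One has $0<\Re\lambda_j<k+1$ whenever $\langle\sigma(\mathbb S)e_j,e_j\rangle>0$, and $$\sum_j\Big(\frac1{k+1-\Re\lambda_j}+\frac1{\Re\lambda_j}\Big)\langle\sigma(\mathbb S)e_j,e_j\rangle<\infty,$$ where terms with $\langle\sigma(\mathbb S)e_j,e_j\rangle=0$ are read as $0$. -/

import Mathlib

open MeasureTheory Filter Topology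
open scoped ENNReal InnerProductSpace

namespace SelfSimilarIRF

/-! ### Trace-class operators and operator-valued measures -/

theorem parseval_enorm {V : Type*} [NormedAddCommGroup V] [InnerProductSpace ℂ V]
    {κ : Type*} (f : HilbertBasis κ ℂ V) (x : V) :
    ‖x‖ₑ ^ 2 = ∑' i, ‖⟪f i, x⟫_ℂ‖ₑ ^ 2 := by
  have h := f.hasSum_inner_mul_inner x x
  have h2 : HasSum (fun i => ‖⟪f i, x⟫_ℂ‖ ^ 2) (‖x‖ ^ 2) := by
    have h3 := Complex.hasSum_re h
    rw [inner_self_eq_norm_sq_to_K] at h3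
    convert h3 using 1
    · funext i
      rw [← inner_conj_symm x (f i), mul_comm, RCLike.mul_conj]
      norm_cast
    · norm_cast
  have e : ∀ y : ℝ, 0 ≤ y → ‖y‖ₑ = ENNReal.ofReal y := fun y hy => by
    rw [← ofReal_norm, Real.norm_of_nonneg hy]
  rw [← ofReal_norm x, ← ENNReal.ofReal_pow (norm_nonneg _), ← h2.tsum_eq,
    ENNReal.ofReal_tsum_of_nonneg (fun i => by positivity) h2.summable]
  refine tsum_congr fun i => ?_
  rw [← ofReal_norm, ← ENNReal.ofReal_pow (norm_nonneg _)]

section Trace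

variable {V : Type*} [NormedAddCommGroup V] [InnerProductSpace ℂ V] [CompleteSpace V]

/-- The trace norm `∑ⱼ ⟨|A| eⱼ, eⱼ⟩`, with `|A| = (A* A)^{1/2}`. It is computed here in some fixed
complete orthonormal system; by `traceNorm_eq_tsum` the choice of the system is irrelevant. -/
noncomputable def traceNorm (A : V →L[ℂ] V) : ℝ≥0∞ :=
  ∑' i, ENNReal.ofReal
    (⟪(exists_hilbertBasis ℂ V).choose_spec.choose i,
      CFC.abs A ((exists_hilbertBasis ℂ V).choose_spec.choose i)⟫_ℂ).re

theorem traceNorm_eq_tsum {ι : Type*} (b : HilbertBasis ι ℂ V) (A : V →L[ℂ] V) :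
    traceNorm A = ∑' i, ENNReal.ofReal (⟪b i, CFC.abs A (b i)⟫_ℂ).re := by
  set S : V →L[ℂ] V := CFC.sqrt (CFC.abs A) with hS
  have hSpos : S.IsPositive :=
    (ContinuousLinearMap.nonneg_iff_isPositive S).1 (CFC.sqrt_nonneg _)
  have hSS : S * S = CFC.abs A := CFC.sqrt_mul_sqrt_self _ (CFC.abs_nonneg A)
  have hin : ∀ v : V, ENNReal.ofReal (⟪v, CFC.abs A v⟫_ℂ).re = ‖S v‖ₑ ^ 2 := by
    intro v
    have : ⟪v, S (S v)⟫_ℂ = ⟪S v, S v⟫_ℂ := (hSpos.isSymmetric v (S v)).symm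
    rw [← hSS, mul_apply_eq_comp, this, inner_self_eq_norm_sq_to_K,
      ← ofReal_norm, ← ENNReal.ofReal_pow (norm_nonneg _)]
    norm_cast
  unfold traceNorm
  simp only [hin]
  simp_rw [fun i => parseval_enorm b (S ((exists_hilbertBasis ℂ V).choose_spec.choose i)),
    fun i => parseval_enorm (exists_hilbertBasis ℂ V).choose_spec.choose (S (b i))]
  rw [ENNReal.tsum_comm]
  refine tsum_congr fun i => tsum_congr fun j => ?_
  have : ⟪b i, S ((exists_hilbertBasis ℂ V).choose_spec.choose j)⟫_ℂ =
      ⟪S (b i), (exists_hilbertBasis ℂ V).choose_spec.choose j⟫_ℂ := (hSpos.isSymmetric _ _).symm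
  rw [this, ← ofReal_norm, norm_inner_symm, ofReal_norm]

/-- `A` is a trace-class operator. -/
def IsTraceClass (A : V →L[ℂ] V) : Prop := traceNorm A < ∞

/-- `μ` is a finite (countably additive) measure whose values are positive trace-class operators.
A `VectorMeasure` is countably additive for the operator norm; for positive trace-class values this
is the same as countable additivity for the trace norm. -/
def IsTPlusMeasure {X : Type*} [MeasurableSpace X] (μ : VectorMeasure X (V →L[ℂ] V)) : Prop :=
  ∀ s, MeasurableSet s → (μ s).IsPositive ∧ IsTraceClass (μ s)

/-- `A` is the Bochner integral of `f` with respect to `ν` in the space of trace-class operators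
with the trace norm. -/
def HasTraceIntegral {X : Type*} [MeasurableSpace X] (ν : Measure X) (f : X → V →L[ℂ] V)
    (A : V →L[ℂ] V) : Prop :=
  AEStronglyMeasurable f ν ∧ ∫⁻ x, traceNorm (f x) ∂ν < ∞ ∧ A = ∫ x, f x ∂ν

/-- The integral `∫ f dμ` of a complex-valued function against an operator-valued measure. -/
noncomputable def opIntegral {X : Type*} [MeasurableSpace X] (μ : VectorMeasure X (V →L[ℂ] V))
    (f : X → ℂ) : V →L[ℂ] V :=
  μ.integral f (ContinuousLinearMap.lsmul ℝ ℂ)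

/-- `c ^ H = exp (log c • H)`. -/
noncomputable def opPow (c : ℝ) (H : V →L[ℂ] V) : V →L[ℂ] V :=
  NormedSpace.exp ((Real.log c : ℂ) • H)

/-- `H` is normal and `H = ∑ⱼ lamⱼ eⱼ ⊗ eⱼ` in the weak operator topology, for the complete
orthonormal system `e` of `V`. -/
def IsNormalDiagonal {ι : Type*} (H : V →L[ℂ] V) (e : HilbertBasis ι ℂ V) (lam : ι → ℂ) : Prop :=
  IsStarNormal H ∧ ∀ x y : V,
    HasSum (fun j => ⟪x, (lam j • InnerProductSpace.rankOne ℂ (e j) (e j)) y⟫_ℂ) ⟪x, H y⟫_ℂ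

end Trace

/-! ### Finitely supported measures annihilating polynomials -/

section Lambda

variable {d : ℕ}

/-- Finitely supported complex measures on `ℝᵈ`; `δ_t` is `Finsupp.single t 1`. -/
abbrev FinMeas (d : ℕ) : Type := EuclideanSpace ℝ (Fin d) →₀ ℂ

/-- The finitely supported measures that annihilate all polynomials of degree at most `k`
(there is no condition for `k = -1`). -/
def Lam (d : ℕ) (k : ℤ) : Submodule ℂ (FinMeas d) where
  carrier := {l | ∀ p : MvPolynomial (Fin d) ℂ, (p.totalDegree : ℤ) ≤ k →
    l.sum (fun t c => c * MvPolynomial.eval (fun i => (t i : ℂ)) p) = 0}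
  zero_mem' := by
    intro p _
    simp
  add_mem' := by
    intro a b ha hb p hp
    rw [Finsupp.sum_add_index' (by simp) (by intros; ring), ha p hp, hb p hp, add_zero]
  smul_mem' := by
    intro z a ha p hp
    rw [Finsupp.sum_smul_index' (by simp)]
    simp only [smul_eq_mul, mul_assoc]
    rw [← Finsupp.mul_sum, ha p hp, mul_zero]

theorem mapDomain_mem_Lam {k : ℤ} (c : ℝ) (w : EuclideanSpace ℝ (Fin d)) {l : FinMeas d}
    (hl : l ∈ Lam d k) : Finsupp.mapDomain (fun t => w + c • t) l ∈ Lam d k := by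
  intro p hp
  rw [Finsupp.sum_mapDomain_index (by simp) (by intros; ring)]
  let q : MvPolynomial (Fin d) ℂ :=
    MvPolynomial.bind₁
      (fun i => MvPolynomial.C (w i : ℂ) + MvPolynomial.C (c : ℂ) * MvPolynomial.X i) p
  have hq : q.totalDegree ≤ p.totalDegree := by
    have hlin : ∀ i, (MvPolynomial.C (w i : ℂ) +
        MvPolynomial.C (c : ℂ) * MvPolynomial.X i : MvPolynomial (Fin d) ℂ).totalDegree ≤ 1 := by
      intro i
      refine (MvPolynomial.totalDegree_add _ _).trans (max_le (by simp) ?_)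
      refine (MvPolynomial.totalDegree_mul _ _).trans (by simp)
    simp only [q, MvPolynomial.bind₁, MvPolynomial.aeval_def, MvPolynomial.eval₂_eq]
    refine MvPolynomial.totalDegree_finsetSum_le fun m hm => ?_
    refine (MvPolynomial.totalDegree_mul _ _).trans ?_
    rw [MvPolynomial.algebraMap_eq, MvPolynomial.totalDegree_C, zero_add]
    refine (MvPolynomial.totalDegree_finsetProd _ _).trans ?_
    refine le_trans (Finset.sum_le_sum fun i _ => ?_) (MvPolynomial.le_totalDegree hm)
    refine (MvPolynomial.totalDegree_pow _ _).trans ?_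
    simpa using Nat.mul_le_mul_left (m i) (hlin i)
  have := hl q (by omega)
  rw [← this]
  refine Finsupp.sum_congr fun t _ => ?_
  congr 1
  simp only [q, MvPolynomial.eval, MvPolynomial.eval₂Hom_bind₁]
  congr 2
  funext i
  simp

/-- The translation `w + l`. -/
noncomputable def translate {k : ℤ} (w : EuclideanSpace ℝ (Fin d)) (l : Lam d k) : Lam d k :=
  ⟨Finsupp.mapDomain (fun t => w + t) l.1, by simpa using mapDomain_mem_Lam 1 w l.2⟩

/-- The dilation `c · l`. -/
noncomputable def dilate {k : ℤ} (c : ℝ) (l : Lam d k) : Lam d k :=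
  ⟨Finsupp.mapDomain (fun t => c • t) l.1, by simpa using mapDomain_mem_Lam c 0 l.2⟩

end Lambda

/-! ### Intrinsic random functions -/

section IRF

variable {V : Type*} [NormedAddCommGroup V] [InnerProductSpace ℂ V] [CompleteSpace V]
  {d : ℕ} {k : ℤ} {Ω : Type*} [MeasurableSpace Ω]

/-- The cross-covariance operator `E[X ⊗ Z]`, where `(f ⊗ g) h = ⟨h, g⟩ f` and the inner product
is linear in the argument `h`. -/
noncomputable def crossCov (P : Measure Ω) (X Z : Ω → V) : V →L[ℂ] V :=
  ∫ ω, InnerProductSpace.rankOne ℂ (X ω) (Z ω) ∂P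

/-- A second order process `Y`, indexed by `Lam d k` and with linear paths, is an intrinsic random
function of order `k`. -/
structure IsIRF [MeasurableSpace V] (P : Measure Ω) (Y : Lam d k →ₗ[ℂ] (Ω → V)) : Prop where
  measurable : ∀ l, Measurable (Y l)
  square_integrable : ∀ l, MemLp (Y l) 2 P
  mean_zero : ∀ l, ∫ ω, Y l ω ∂P = 0
  stationary : ∀ (w : EuclideanSpace ℝ (Fin d)) (l m : Lam d k),
    crossCov P (Y l) (Y m) = crossCov P (Y (translate w l)) (Y (translate w m))

/-- `Y` has a mean-square continuous representation `X`, where a representation is a random field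
on `ℝᵈ` with `Y(l) = ∫ X dl`. Two representations differ by a (random) polynomial of degree at most
`k`, so this does not depend on the representation. -/
def IsMeanSquareContinuous (P : Measure Ω) (Y : Lam d k →ₗ[ℂ] (Ω → V)) : Prop :=
  ∃ X : EuclideanSpace ℝ (Fin d) → Ω → V,
    (∀ t, MemLp (X t) 2 P) ∧
    (∀ (l : Lam d k) (ω : Ω), Y l ω = l.1.sum fun t c => c • X t ω) ∧
    ∀ t, Tendsto (fun s => eLpNorm (X s - X t) 2 P) (𝓝 t) (𝓝 0)

/-- Covariance `H`-self-similarity: `{Y(c · l)}` and `{c ^ H Y(l)}` have the same cross-covariance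
for every `c > 0`. -/
def IsCovSelfSimilar (P : Measure Ω) (Y : Lam d k →ₗ[ℂ] (Ω → V)) (H : V →L[ℂ] V) : Prop :=
  ∀ c : ℝ, 0 < c → ∀ l m : Lam d k,
    crossCov P (Y (dilate c l)) (Y (dilate c m)) =
      crossCov P (fun ω => opPow c H (Y l ω)) (fun ω => opPow c H (Y m ω))

/-- `K(l * m~) = ∑ⱼ ∑ⱼ' cⱼ conj(cⱼ') K(tⱼ - sⱼ')`. -/
noncomputable def convEval (K : EuclideanSpace ℝ (Fin d) → V →L[ℂ] V) (l m : FinMeas d) :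
    V →L[ℂ] V :=
  l.sum fun t a => m.sum fun s b => (a * (starRingEnd ℂ) b) • K (t - s)

/-- `Q` is a polynomial of degree at most `n` with trace-class coefficients. -/
def IsTracePolynomial (n : ℤ) (Q : EuclideanSpace ℝ (Fin d) → V →L[ℂ] V) : Prop :=
  ∃ a : (Fin d →₀ ℕ) →₀ (V →L[ℂ] V),
    (∀ j ∈ a.support, IsTraceClass (a j) ∧ ((∑ i, j i : ℕ) : ℤ) ≤ n) ∧
    ∀ h, Q h = a.sum fun j A => ((∏ i, h i ^ j i : ℝ) : ℂ) • A

/-- Conditional positive definiteness of degree `k`. -/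
def IsCondPosDef (k : ℤ) (K : EuclideanSpace ℝ (Fin d) → V →L[ℂ] V) : Prop :=
  ∀ l ∈ Lam d k, (convEval K l l).IsPositive

/-- The function
`K(h) = ∫ (exp(i uᵀh) - 1_B(u) P(uᵀh)) / (1 ∧ ‖u‖^(2k+2)) χ(du) + Q(h)`,
with `P(x) = ∑_{j ≤ 2k+1} (i x)^j / j!`. -/
noncomputable def spectralKernel (k : ℤ) (B : Set (EuclideanSpace ℝ (Fin d)))
    (χ : VectorMeasure (EuclideanSpace ℝ (Fin d)) (V →L[ℂ] V))
    (Q : EuclideanSpace ℝ (Fin d) → V →L[ℂ] V) (h : EuclideanSpace ℝ (Fin d)) : V →L[ℂ] V :=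
  opIntegral χ (fun u =>
    (Complex.exp (Complex.I * (⟪u, h⟫_ℝ : ℝ)) -
      B.indicator (fun u => ∑ j ∈ Finset.range (2 * k + 2).toNat,
        (Complex.I * (⟪u, h⟫_ℝ : ℝ)) ^ j / (j.factorial : ℂ)) u) /
      ((min 1 (‖u‖ ^ (2 * k + 2)) : ℝ) : ℂ)) + Q h

/-- `(χ, Q)` are the spectral characteristics of `Y`: `χ` is a finite measure with values in the
positive trace-class operators and without mass at `0` (the spectral measure of `Y`), `Q` is a
conditionally positive definite polynomial of degree at most `2k+2`, and the function `K` that they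
define is a generalized covariance of `Y`, that is `E[Y(l) ⊗ Y(m)] = K(l * m~)`. The bounded
neighbourhood `B` of `0` is immaterial: changing it changes `K` by a polynomial of degree at most
`2k+1`, which `l * m~` annihilates. -/
def HasSpectralCharacteristics (P : Measure Ω) (Y : Lam d k →ₗ[ℂ] (Ω → V))
    (χ : VectorMeasure (EuclideanSpace ℝ (Fin d)) (V →L[ℂ] V))
    (Q : EuclideanSpace ℝ (Fin d) → V →L[ℂ] V) : Prop :=
  IsTPlusMeasure χ ∧ χ {0} = 0 ∧ IsTracePolynomial (2 * k + 2) Q ∧ IsCondPosDef k Q ∧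
    ∃ B : Set (EuclideanSpace ℝ (Fin d)),
      MeasurableSet B ∧ Bornology.IsBounded B ∧ B ∈ 𝓝 0 ∧
      ∀ l m : Lam d k, crossCov P (Y l) (Y m) = convEval (spectralKernel k B χ Q) l.1 m.1

/-- There is an `L²`-continuous covariance `H`-self-similar intrinsic random function of order `k`
with spectral characteristics `(χ, Q)`. -/
def ExistsSelfSimilarIRF.{u, w} {V : Type u} [NormedAddCommGroup V] [InnerProductSpace ℂ V]
    [CompleteSpace V] [MeasurableSpace V] {d : ℕ} (k : ℤ) (H : V →L[ℂ] V)
    (χ : VectorMeasure (EuclideanSpace ℝ (Fin d)) (V →L[ℂ] V))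
    (Q : EuclideanSpace ℝ (Fin d) → V →L[ℂ] V) : Prop :=
  ∃ (Ω : Type w) (_ : MeasurableSpace Ω) (P : Measure Ω) (Y : Lam d k →ₗ[ℂ] (Ω → V)),
    IsProbabilityMeasure P ∧ IsIRF P Y ∧ IsMeanSquareContinuous P Y ∧ IsCovSelfSimilar P Y H ∧
      HasSpectralCharacteristics P Y χ Q

/-- In polar coordinates, `χ(dr dθ) = (1 ∧ r^(2k+2)) r^{-H} σ(dθ) r^{-H*} dr / r`: for all Borel
sets `D` bounded away from `0`,
`χ(D) = ∫_0^∞ (1 ∧ r^(2k+2)) r^{-H} σ{θ : rθ ∈ D} r^{-H*} dr / r`. -/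
def HasPolarForm (k : ℤ) (H : V →L[ℂ] V)
    (σ : VectorMeasure (Metric.sphere (0 : EuclideanSpace ℝ (Fin d)) 1) (V →L[ℂ] V))
    (χ : VectorMeasure (EuclideanSpace ℝ (Fin d)) (V →L[ℂ] V)) : Prop :=
  ∀ D : Set (EuclideanSpace ℝ (Fin d)), MeasurableSet D →
    (∃ ε : ℝ, 0 < ε ∧ ∀ x ∈ D, ε ≤ ‖x‖) →
    HasTraceIntegral (volume.restrict (Set.Ioi (0 : ℝ)))
      (fun r => (min 1 (r ^ (2 * k + 2)) * r⁻¹ : ℝ) •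
        (opPow r (-H) * σ {θ | r • (θ : EuclideanSpace ℝ (Fin d)) ∈ D} *
          opPow r (-ContinuousLinearMap.adjoint H)))
      (χ D)

end IRF

end SelfSimilarIRF

open SelfSimilarIRF

universe u v w

/-! Write `n = k + 1`, `a_j = Re λ_j` and `s_j = ⟨σ(𝕊)e_j, e_j⟩`. Each statement is equivalent to
finiteness of one number, the integral over `r` of the trace norm of `polarIntegrand` on the whole
space.

Link with statement 3: `e_j` is an eigenvector of `H*`, so the trace of the integrand in this basis
is `∑ s_j (1 ∧ r^(2n)) r^(-2a_j-1)`. Its `j`-th radial integral is finite exactly for `0 < a_j < n`,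
with value `(1/(n-a_j) + 1/a_j)/2` (`tsum_radialIntegral_ne_top_iff`).

Necessity (`lintegral_traceNorm_polarIntegrand_of_hasPolarForm`): the polar form on `{‖u‖ ≥ ε}`
bounds the truncated integral by `tr χ(ℝᵈ)`, and `ε` decreases to `0`. The polynomial component
plays no role.

Sufficiency: if the number is finite, `polarMeasure` is a finite measure with positive trace-class
values. Any such measure without mass at `0` is a spectral measure (`exists_irf_of_isTPlusMeasure`):
with `f_t` the weighted Taylor remainder of `exp(i uᵀt)`, the kernel `∫ f_t conj(f_s) dχ` is
positive semidefinite, and a Parseval frame of its reproducing kernel space writes it as `∑ p_n(t) ⊗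
p_n(s)` (`exists_factorization`). Drawing `n` with probability `2^(-n-1)` and an independent sign,
the field `± 2^((n+1)/2) p_n(t)` is centred with this covariance, so no Gaussian process is needed.
On `Λ_k` the Taylor terms cancel and the covariance is `spectralCov`.

Self-similarity (`spectralCov_polarMeasure_dilate`): dividing the quadratic form of `χ` at `x` by `1
∧ ‖u‖^(2n)` leaves a measure `ν_x` which dilation by `c` carries to `ν_y`, `y = c^{H*} x`. Dilating
the index replaces `l̂(u)` by `l̂(cu)`, so the covariance is conjugated by `c^H`. -/

namespace SelfSimilarIRF

open scoped ComplexConjugate ComplexOrder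

/-! ### Positive operators, quadratic forms and the trace norm. -/

section Positive

variable {V : Type*} [NormedAddCommGroup V] [InnerProductSpace ℂ V]

/-- Complex polarization. It reduces the operator identities below to identities between scalar
integrals. -/
theorem ext_quadratic {A B : V →L[ℂ] V} (h : ∀ x, ⟪x, A x⟫_ℂ = ⟪x, B x⟫_ℂ) : A = B := by
  have : (A : V →ₗ[ℂ] V) = B := by
    rw [← ext_inner_map]
    intro x
    have := congrArg (starRingEnd ℂ) (h x)
    rw [inner_conj_symm, inner_conj_symm] at this
    exact this
  ext x
  exact congrArg (fun L : V →ₗ[ℂ] V => L x) this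

theorem inner_eq_re_of_isPositive {A : V →L[ℂ] V} (hA : A.IsPositive) (x : V) :
    ⟪x, A x⟫_ℂ = ((⟪x, A x⟫_ℂ).re : ℂ) := by
  have h := hA.inner_nonneg_right x
  rw [Complex.le_def] at h
  apply Complex.ext
  · simp
  · simpa using h.2.symm

theorem re_inner_nonneg_of_isPositive {A : V →L[ℂ] V} (hA : A.IsPositive) (x : V) :
    0 ≤ (⟪x, A x⟫_ℂ).re := by
  have h := hA.inner_nonneg_right x
  rw [Complex.le_def] at h
  simpa using h.1

variable [CompleteSpace V]

theorem traceNorm_of_isPositive {ι : Type*} (b : HilbertBasis ι ℂ V) {A : V →L[ℂ] V}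
    (hA : A.IsPositive) : traceNorm A = ∑' i, ENNReal.ofReal (⟪b i, A (b i)⟫_ℂ).re := by
  rw [traceNorm_eq_tsum b]
  rw [CFC.abs_of_nonneg A ((ContinuousLinearMap.nonneg_iff_isPositive A).2 hA)]

/-- With `A = S²`, Parseval and Cauchy–Schwarz bound `‖S x‖²` by `(∑ ‖S b_i‖²) ‖x‖²`, and the sum is
the trace of `A`. -/
theorem enorm_le_traceNorm {A : V →L[ℂ] V} (hA : A.IsPositive) : ‖A‖ₑ ≤ traceNorm A := by
  obtain ⟨w, b, -⟩ := exists_hilbertBasis ℂ V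
  rw [traceNorm_of_isPositive b hA]
  have hA0 := (ContinuousLinearMap.nonneg_iff_isPositive A).2 hA
  set S : V →L[ℂ] V := CFC.sqrt A with hS
  have hSpos : S.IsPositive :=
    (ContinuousLinearMap.nonneg_iff_isPositive S).1 (CFC.sqrt_nonneg _)
  have hSS : S * S = A := CFC.sqrt_mul_sqrt_self _ hA0
  have hin : ∀ v : V, ENNReal.ofReal (⟪v, A v⟫_ℂ).re = ‖S v‖ₑ ^ 2 := by
    intro v
    have : ⟪v, S (S v)⟫_ℂ = ⟪S v, S v⟫_ℂ := (hSpos.isSymmetric v (S v)).symm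
    rw [← hSS, mul_apply_eq_comp, this, inner_self_eq_norm_sq_to_K,
      ← ofReal_norm, ← ENNReal.ofReal_pow (norm_nonneg _)]
    norm_cast
  simp only [hin]
  set T := ∑' i, ‖S (b i)‖ₑ ^ 2 with hT
  have hbd : ∀ x, ‖S x‖ₑ ^ 2 ≤ T * ‖x‖ₑ ^ 2 := by
    intro x
    rw [parseval_enorm b, hT, ← ENNReal.tsum_mul_right]
    refine ENNReal.tsum_le_tsum fun i => ?_
    have : ⟪b i, S x⟫_ℂ = ⟪S (b i), x⟫_ℂ := (hSpos.isSymmetric _ _).symm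
    rw [this, ← mul_pow]
    gcongr
    have h := norm_inner_le_norm (𝕜 := ℂ) (S (b i)) x
    rw [← ofReal_norm, ← ofReal_norm, ← ofReal_norm, ← ENNReal.ofReal_mul (norm_nonneg _)]
    exact ENNReal.ofReal_le_ofReal h
  have hS2 : ‖A‖ₑ ≤ ‖S‖ₑ ^ 2 := by
    rw [← hSS, sq, ← ofReal_norm, ← ofReal_norm, ← ENNReal.ofReal_mul (norm_nonneg _)]
    exact ENNReal.ofReal_le_ofReal (norm_mul_le _ _)
  refine hS2.trans ?_
  by_cases hTtop : T = ∞
  · simp [hTtop]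
  have hbd' : ∀ x, ‖S x‖ ≤ √T.toReal * ‖x‖ := by
    intro x
    have h := ENNReal.toReal_mono (by finiteness) (hbd x)
    simp only [ENNReal.toReal_pow, toReal_enorm, ENNReal.toReal_mul] at h
    have := Real.sqrt_le_sqrt h
    rwa [Real.sqrt_sq (norm_nonneg _), Real.sqrt_mul ENNReal.toReal_nonneg,
      Real.sqrt_sq (norm_nonneg _)] at this
  have hSn := S.opNorm_le_bound (Real.sqrt_nonneg _) hbd'
  rw [← ofReal_norm, ← ENNReal.ofReal_pow (norm_nonneg _)]
  refine ENNReal.ofReal_le_of_le_toReal ?_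
  calc ‖S‖ ^ 2 ≤ √T.toReal ^ 2 := by gcongr
    _ = T.toReal := Real.sq_sqrt ENNReal.toReal_nonneg

end Positive

theorem hasSum_inner_apply {V : Type*} [NormedAddCommGroup V] [InnerProductSpace ℂ V]
    {ι : Type*} {A : ι → V →L[ℂ] V} {B : V →L[ℂ] V} (h : HasSum A B)
    (x y : V) : HasSum (fun i => ⟪x, A i y⟫_ℂ) ⟪x, B y⟫_ℂ := by
  have h1 := (ContinuousLinearMap.apply ℂ V y).hasSum h
  exact (innerSL ℂ x).hasSum h1

/-! ### Scalar measures attached to an operator-valued measure. -/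

section QuadMeasure

variable {V : Type*} [NormedAddCommGroup V] [InnerProductSpace ℂ V]
  {X : Type*} [MeasurableSpace X] {χ : VectorMeasure X (V →L[ℂ] V)}

/-- The scalar measure `D ↦ ⟨χ(D) x, x⟩` of a measure with values in the positive operators. -/
noncomputable def quadMeasure (hχ : ∀ s, MeasurableSet s → (χ s).IsPositive) (x : V) :
    Measure X :=
  Measure.ofMeasurable (fun s _ => ENNReal.ofReal (⟪x, χ s x⟫_ℂ).re) (by simp)
    (fun f hf hd => by
      have h := Complex.hasSum_re (hasSum_inner_apply (χ.m_iUnion hf hd) x x)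
      rw [← h.tsum_eq, ENNReal.ofReal_tsum_of_nonneg
        (fun i => re_inner_nonneg_of_isPositive (hχ _ (hf i)) x) h.summable])

variable (hχ : ∀ s, MeasurableSet s → (χ s).IsPositive)

theorem quadMeasure_apply (x : V) {s : Set X} (hs : MeasurableSet s) :
    quadMeasure hχ x s = ENNReal.ofReal (⟪x, χ s x⟫_ℂ).re :=
  Measure.ofMeasurable_apply s hs

instance (x : V) : IsFiniteMeasure (quadMeasure hχ x) :=
  ⟨by rw [quadMeasure_apply hχ x .univ]; exact ENNReal.ofReal_lt_top⟩

theorem quadMeasure_real (x : V) {s : Set X} (hs : MeasurableSet s) :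
    (((quadMeasure hχ x).real s : ℝ) : ℂ) = ⟪x, χ s x⟫_ℂ := by
  rw [Measure.real, quadMeasure_apply hχ x hs, ENNReal.toReal_ofReal
    (re_inner_nonneg_of_isPositive (hχ _ hs) x), ← inner_eq_re_of_isPositive (hχ _ hs)]

variable [CompleteSpace V]

/-- Integrability for the variation thus passes to every scalar measure. -/
theorem quadMeasure_le (x : V) : quadMeasure hχ x ≤ ‖x‖ₑ ^ 2 • χ.variation := by
  refine Measure.le_iff.2 fun s hs => ?_
  rw [quadMeasure_apply hχ x hs, Measure.smul_apply, smul_eq_mul]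
  refine le_trans ?_ (mul_le_mul_right (VectorMeasure.enorm_measure_le_variation χ s) _)
  rw [← ofReal_norm, ← ofReal_norm, ← ENNReal.ofReal_pow (norm_nonneg _),
    ← ENNReal.ofReal_mul (by positivity)]
  refine ENNReal.ofReal_le_ofReal ?_
  calc (⟪x, χ s x⟫_ℂ).re ≤ ‖⟪x, χ s x⟫_ℂ‖ := Complex.re_le_norm _
    _ ≤ ‖x‖ * ‖χ s x‖ := norm_inner_le_norm _ _
    _ ≤ ‖x‖ * (‖χ s‖ * ‖x‖) := by gcongr; exact (χ s).le_opNorm x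
    _ = ‖x‖ ^ 2 * ‖χ s‖ := by ring

/-- The trace measure `D ↦ tr χ(D)`. -/
noncomputable def traceMeasure {ι : Type*} (b : HilbertBasis ι ℂ V)
    (hχ : ∀ s, MeasurableSet s → (χ s).IsPositive) : Measure X :=
  Measure.sum fun i => quadMeasure hχ (b i)

theorem traceMeasure_apply {ι : Type*} (b : HilbertBasis ι ℂ V) {s : Set X}
    (hs : MeasurableSet s) : traceMeasure b hχ s = traceNorm (χ s) := by
  rw [traceMeasure, Measure.sum_apply _ hs, traceNorm_of_isPositive b (hχ s hs)]
  exact tsum_congr fun i => quadMeasure_apply hχ _ hs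

/-- The variation is taken in operator norm; domination by the trace measure makes it finite, so
bounded measurable functions are integrable. -/
theorem variation_le_traceMeasure {ι : Type*} (b : HilbertBasis ι ℂ V) :
    χ.variation ≤ traceMeasure b hχ :=
  VectorMeasure.variation_le_of_forall_enorm_le fun s hs => by
    rw [traceMeasure_apply hχ b hs]
    exact enorm_le_traceNorm (hχ s hs)

theorem isFiniteMeasure_traceMeasure {ι : Type*} (b : HilbertBasis ι ℂ V)
    (hT : IsTPlusMeasure χ) : IsFiniteMeasure (traceMeasure b fun s hs => (hT s hs).1) :=
  ⟨by rw [traceMeasure_apply _ b .univ]; exact (hT _ .univ).2⟩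

theorem isFiniteMeasure_variation (hT : IsTPlusMeasure χ) : IsFiniteMeasure χ.variation := by
  obtain ⟨w, b, -⟩ := exists_hilbertBasis ℂ V
  have := isFiniteMeasure_traceMeasure b hT
  exact isFiniteMeasure_of_le _ (variation_le_traceMeasure (fun s hs => (hT s hs).1) b)

/-- The bridge from operator integrals to scalar ones: true on indicators by definition of
`quadMeasure`, then extended by linearity and density in `L¹` of the variation. -/
theorem inner_opIntegral {f : X → ℂ} (hf : Integrable f χ.variation) (x : V) :
    ⟪x, opIntegral χ f x⟫_ℂ = ∫ u, f u ∂quadMeasure hχ x := by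
  have hfin : ‖x‖ₑ ^ 2 ≠ ∞ := by finiteness
  have hle := quadMeasure_le hχ x
  unfold opIntegral
  apply hf.induction (P := fun f => ⟪x, (χ.integral f (ContinuousLinearMap.lsmul ℝ ℂ)) x⟫_ℂ
    = ∫ u, f u ∂quadMeasure hχ x)
  · intro c s hs hc
    have : IsFiniteMeasure (χ.variation.restrict s) := ⟨by simpa⟩
    rw [VectorMeasure.integral_indicator_const _ hs, integral_indicator_const _ hs]
    rw [Complex.real_smul, quadMeasure_real hχ x hs]
    change ⟪x, c • (χ s x)⟫_ℂ = _
    rw [inner_smul_right, mul_comm]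
  · intro f g _ f_int g_int hf hg
    rw [VectorMeasure.integral_add f_int g_int, integral_add'
      (f_int.of_measure_le_smul hfin hle) (g_int.of_measure_le_smul hfin hle), ← hf, ← hg, add_apply,
      inner_add_right]
  · have h_int : ∀ g : X → ℂ, Integrable g χ.variation → Integrable g (quadMeasure hχ x) :=
      fun g hg => Integrable.of_measure_le_smul hfin hle hg
    apply isClosed_eq
    · have h1 : Continuous fun A : V →L[ℂ] V => ⟪x, A x⟫_ℂ := by fun_prop
      exact h1.comp VectorMeasure.continuous_integral
    -- The scalar integral factors through the continuous map from `L¹` of the variation to `L¹` of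
    -- the dominated measure `quadMeasure`.
    · have : (fun f : X →₁[χ.variation] ℂ => ∫ u, f u ∂quadMeasure hχ x) =
          fun f : X →₁[χ.variation] ℂ =>
            ∫ u, ((h_int f (L1.integrable_coeFn f)).toL1 f) u ∂quadMeasure hχ x := by
        ext1 f
        exact integral_congr_ae (Integrable.coeFn_toL1 _).symm
      rw [this]
      exact continuous_integral.comp (continuous_L1_toL1 _ hfin hle)
  · intro f g hfg _ hf
    rw [← VectorMeasure.integral_congr_ae hfg, hf]
    exact integral_congr_ae ((Measure.absolutelyContinuous_of_le_smul hle).ae_eq hfg)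

end QuadMeasure

/-! ### Operator integrals: limits, adjoints and positive semidefinite kernels. -/

section OpIntegral

variable {V : Type*} [NormedAddCommGroup V] [InnerProductSpace ℂ V] [CompleteSpace V]
  {X : Type*} [MeasurableSpace X] {χ : VectorMeasure X (V →L[ℂ] V)}

theorem integrable_variation (hT : IsTPlusMeasure χ) {f : X → ℂ} (hf : Measurable f) {C : ℝ}
    (hC : ∀ u, ‖f u‖ ≤ C) : Integrable f χ.variation := by
  have := isFiniteMeasure_variation hT
  exact Integrable.of_bound hf.aestronglyMeasurable C (.of_forall hC)

theorem tendsto_opIntegral (hT : IsTPlusMeasure χ) {F : ℕ → X → ℂ} {f : X → ℂ}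
    (hF : ∀ n, Measurable (F n)) {C : ℝ} (hC : ∀ n u, ‖F n u‖ ≤ C)
    (hlim : ∀ u, Tendsto (fun n => F n u) atTop (𝓝 (f u))) :
    Tendsto (fun n => opIntegral χ (F n)) atTop (𝓝 (opIntegral χ f)) := by
  have := isFiniteMeasure_variation hT
  exact VectorMeasure.tendsto_integral_of_dominated_convergence (fun _ => C)
    (fun n => (hF n).aestronglyMeasurable) (integrable_const C) (fun n => .of_forall (hC n))
    (.of_forall hlim)

theorem opIntegral_simpleFunc (hT : IsTPlusMeasure χ) {E : Type*} [NormedAddCommGroup E]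
    (G : SimpleFunc X E) (h : E → ℂ) (h0 : h 0 = 0) :
    opIntegral χ (fun u => h (G u)) = ∑ y ∈ G.range, h y • χ (G ⁻¹' {y}) := by
  have hχ := fun s hs => (hT s hs).1
  have hfin := isFiniteMeasure_variation hT
  have hi : ∀ (μ : Measure X) [IsFiniteMeasure μ], Integrable (G.map h) μ := fun μ _ =>
    SimpleFunc.integrable_of_isFiniteMeasure _
  have hi2 : ∀ (μ : Measure X) [IsFiniteMeasure μ], Integrable G μ := fun μ _ =>
    SimpleFunc.integrable_of_isFiniteMeasure _
  refine ext_quadratic fun x => ?_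
  have h1 := inner_opIntegral hχ (hi χ.variation) x
  rw [← SimpleFunc.integral_eq_integral _ (hi _), SimpleFunc.map_integral _ _ (hi2 _) h0] at h1
  refine Eq.trans h1 ?_
  rw [sum_apply, inner_sum]
  refine Finset.sum_congr rfl fun y _ => ?_
  rw [Complex.real_smul, quadMeasure_real hχ x (G.measurableSet_fiber y), smul_apply,
    inner_smul_right, mul_comm]

/-- The tuple `(f i)` is approximated by simple functions with values in `ι → ℂ`, so that all
components share one partition. On the cell `{G = y}` the double sum is the quadratic form of a
positive operator at `∑ conj(y i) • w i`. -/
theorem sum_inner_opIntegral_nonneg (hT : IsTPlusMeasure χ) {ι : Type*} [Fintype ι]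
    {f : ι → X → ℂ} (hf : ∀ i, Measurable (f i)) {C : ℝ} (hC : ∀ i u, ‖f i u‖ ≤ C) (w : ι → V) :
    0 ≤ (∑ i, ∑ j, ⟪opIntegral χ (fun u => f j u * conj (f i u)) (w i), w j⟫_ℂ).re := by
  have hχ := fun s hs => (hT s hs).1
  wlog hC0 : 0 ≤ C generalizing C
  · exact this (C := max C 0) (fun i u => (hC i u).trans (le_max_left _ _)) (le_max_right _ _)
  have hFm : StronglyMeasurable (fun u i => f i u) :=
    (measurable_pi_iff.2 hf).stronglyMeasurable
  have hFb : ∀ u, ‖fun i => f i u‖ ≤ C := fun u => (pi_norm_le_iff_of_nonneg hC0).2 fun i => hC i u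
  set G := hFm.approxBounded C
  have hG : ∀ n u, ‖G n u‖ ≤ C := fun n u => hFm.norm_approxBounded_le hC0 n u
  have hG' : ∀ n u i, ‖G n u i‖ ≤ C := fun n u i => (norm_le_pi_norm _ _).trans (hG n u)
  have hlim : ∀ u i, Tendsto (fun n => G n u i) atTop (𝓝 (f i u)) := fun u i =>
    tendsto_pi_nhds.1 (hFm.tendsto_approxBounded_of_norm_le (hFb u)) i
  have hGm : ∀ n i, Measurable fun u => G n u i := fun n i =>
    (measurable_pi_apply i).comp (G n).measurable
  have key : ∀ n, 0 ≤
      (∑ i, ∑ j, ⟪opIntegral χ (fun u => G n u j * conj (G n u i)) (w i), w j⟫_ℂ).re := by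
    intro n
    have e : (∑ i, ∑ j, ⟪opIntegral χ (fun u => G n u j * conj (G n u i)) (w i), w j⟫_ℂ)
        = ∑ y ∈ (G n).range,
          ⟪χ (G n ⁻¹' {y}) (∑ i, conj (y i) • w i), ∑ j, conj (y j) • w j⟫_ℂ := by
      have : ∀ i j, opIntegral χ (fun u => G n u j * conj (G n u i))
          = ∑ y ∈ (G n).range, (y j * conj (y i)) • χ (G n ⁻¹' {y}) := fun i j =>
        opIntegral_simpleFunc hT (G n) (fun y => y j * conj (y i)) (by simp)
      simp only [this, map_sum, sum_inner, sum_apply, inner_sum, smul_apply, map_smul,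
        inner_smul_left, inner_smul_right, map_mul, Complex.conj_conj]
      calc _ = ∑ i, ∑ y ∈ (G n).range, ∑ j, conj (y j) * y i * ⟪χ (G n ⁻¹' {y}) (w i), w j⟫_ℂ :=
            Finset.sum_congr rfl fun i _ => Finset.sum_comm
        _ = _ := by
          rw [Finset.sum_comm]
          refine Finset.sum_congr rfl fun y _ => ?_
          simp only [Finset.mul_sum]
          rw [Finset.sum_comm]
          refine Finset.sum_congr rfl fun i _ => Finset.sum_congr rfl fun j _ => by ring
    rw [e, Complex.re_sum]
    refine Finset.sum_nonneg fun y _ => ?_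
    rw [← inner_conj_symm, Complex.conj_re]
    have h := (hχ _ ((G n).measurableSet_fiber y))
    exact re_inner_nonneg_of_isPositive h _
  refine ge_of_tendsto' (x := atTop) ?_ key
  refine (Complex.continuous_re.tendsto _).comp ?_
  refine tendsto_finsetSum _ fun i _ => tendsto_finsetSum _ fun j _ => ?_
  have ht : Tendsto (fun n => opIntegral χ (fun u => G n u j * conj (G n u i))) atTop
      (𝓝 (opIntegral χ (fun u => f j u * conj (f i u)))) := by
    refine tendsto_opIntegral hT (C := C * C) (fun n => ?_) (fun n u => ?_) fun u => ?_
    · exact (hGm n j).mul (Complex.continuous_conj.measurable.comp (hGm n i))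
    · rw [norm_mul, RCLike.norm_conj]
      exact mul_le_mul (hG' n u j) (hG' n u i) (norm_nonneg _) hC0
    · exact (hlim u j).mul ((Complex.continuous_conj.tendsto _).comp (hlim u i))
  have hc : Continuous fun A : V →L[ℂ] V => ⟪A (w i), w j⟫_ℂ := by fun_prop
  exact (hc.tendsto _).comp ht

theorem adjoint_opIntegral (hT : IsTPlusMeasure χ) {f : X → ℂ} (hf : Measurable f) {C : ℝ}
    (hC : ∀ u, ‖f u‖ ≤ C) :
    ContinuousLinearMap.adjoint (opIntegral χ f) = opIntegral χ fun u => conj (f u) := by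
  have hχ := fun s hs => (hT s hs).1
  refine ext_quadratic fun x => ?_
  rw [ContinuousLinearMap.adjoint_inner_right, ← inner_conj_symm,
    inner_opIntegral hχ (integrable_variation hT hf hC), inner_opIntegral (f := fun u => conj (f u))
      hχ (integrable_variation hT (Complex.continuous_conj.measurable.comp hf)
        (C := C) (by simpa using hC)), integral_conj]

/-- The operator-valued kernel `(t, s) ↦ ∫ f t * conj (f s) dχ`. -/
noncomputable def opKernel {T : Type*} (χ : VectorMeasure X (V →L[ℂ] V)) (f : T → X → ℂ) :
    Matrix T T (V →L[ℂ] V) :=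
  .of fun t s => opIntegral χ fun u => f t u * conj (f s u)

theorem posSemidef_opKernel (hT : IsTPlusMeasure χ) {T : Type*} {f : T → X → ℂ}
    (hf : ∀ t, Measurable (f t)) (hb : ∀ t, ∃ C, ∀ u, ‖f t u‖ ≤ C) :
    (opKernel χ f).PosSemidef := by
  choose C hC using hb
  have htfae : (opKernel χ f).PosSemidef ↔ (opKernel χ f).IsHermitian ∧ ∀ (vv : T →₀ V),
      0 ≤ RCLike.re (vv.sum fun x w => vv.sum fun x' w' => ⟪opKernel χ f x' x w, w'⟫_ℂ) :=
    RKHS.posSemidef_tfae.out 0 2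
  refine htfae.2 ⟨?_, fun vv => ?_⟩
  · ext1 t s
    rw [Matrix.conjTranspose_apply, ContinuousLinearMap.star_eq_adjoint]
    change ContinuousLinearMap.adjoint (opIntegral χ _) = opIntegral χ _
    rw [adjoint_opIntegral (f := fun u => f s u * conj (f t u)) hT (C := C s * C t)
      ((hf s).mul (Complex.continuous_conj.measurable.comp (hf t)))]
    · congr 1
      funext u
      simp [mul_comm]
    · intro u
      rw [norm_mul, RCLike.norm_conj]
      exact mul_le_mul (hC s u) (hC t u) (norm_nonneg _) ((norm_nonneg _).trans (hC s u))
  · obtain ⟨C', hC'⟩ : ∃ C', ∀ (i : vv.support) u, ‖f i u‖ ≤ C' :=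
      ⟨∑ t ∈ vv.support, |C t|, fun i u => ((hC i u).trans (le_abs_self _)).trans
        (Finset.single_le_sum (f := fun t => |C t|) (fun _ _ => abs_nonneg _) i.2)⟩
    have := sum_inner_opIntegral_nonneg hT (ι := vv.support) (f := fun i => f i)
      (fun i => hf i) hC' (fun i => vv i)
    convert this using 2
    refine congrArg _ ?_
    simp only [Finsupp.sum]
    rw [← Finset.sum_coe_sort]
    refine Finset.sum_congr rfl fun i _ => ?_
    rw [← Finset.sum_coe_sort]
    rfl

end OpIntegral

/-! ### Parseval frames indexed by the natural numbers. -/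

section Frame

variable {E : Type*} [NormedAddCommGroup E] [InnerProductSpace ℂ E]

/-- Distinct basis vectors are at distance `√2 > 1`, so the balls of radius `1/2` around them are
disjoint. -/
theorem countable_of_hilbertBasis [TopologicalSpace.SeparableSpace E] {ι : Type*}
    (b : HilbertBasis ι ℂ E) : Countable ι := by
  refine Pairwise.countable_of_isOpen_disjoint (s := fun i => Metric.ball (b i) (1 / 2))
    (fun i j hij => ?_) (fun i => Metric.isOpen_ball) (fun i => ⟨b i, by simp⟩)
  refine Set.disjoint_left.2 fun z hz hz' => ?_
  rw [Metric.mem_ball, dist_comm] at hz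
  rw [Metric.mem_ball] at hz'
  have h1 : ‖b i - b j‖ < 1 := by
    rw [← dist_eq_norm]
    linarith [dist_triangle (b i) z (b j)]
  have h2 := b.orthonormal.inner_eq_zero hij
  have h3 := norm_sub_sq (𝕜 := ℂ) (b i) (b j)
  rw [h2, b.orthonormal.norm_eq_one, b.orthonormal.norm_eq_one] at h3
  norm_num at h3
  nlinarith [norm_nonneg (b i - b j)]

/-- A separable Hilbert space has a Parseval frame indexed by the natural numbers. -/
theorem exists_parseval_frame [CompleteSpace E] [TopologicalSpace.SeparableSpace E] :
    ∃ b : ℕ → E, ∀ x y : E, HasSum (fun n => ⟪x, b n⟫_ℂ * ⟪b n, y⟫_ℂ) ⟪x, y⟫_ℂ := by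
  obtain ⟨w, b, -⟩ := exists_hilbertBasis ℂ E
  have := countable_of_hilbertBasis b
  obtain ⟨g, hg⟩ := exists_injective_nat w
  -- Padding a basis with zero vectors preserves Parseval's identity and treats finite and infinite
  -- dimension alike.
  refine ⟨Function.extend g b 0, fun x y => ?_⟩
  have h := b.hasSum_inner_mul_inner x y
  rw [← hasSum_extend_zero hg] at h
  refine h.congr_fun fun n => ?_
  by_cases hn : ∃ i, g i = n
  · obtain ⟨i, rfl⟩ := hn
    simp [hg.extend_apply]
  · simp [Function.extend_apply' _ _ _ hn]

theorem tsum_enorm_inner_sq_of_frame {b : ℕ → E}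
    (hb : ∀ x y : E, HasSum (fun n => ⟪x, b n⟫_ℂ * ⟪b n, y⟫_ℂ) ⟪x, y⟫_ℂ) (x : E) :
    ∑' n, ‖⟪x, b n⟫_ℂ‖ₑ ^ 2 = ‖x‖ₑ ^ 2 := by
  have h2 : HasSum (fun i => ‖⟪x, b i⟫_ℂ‖ ^ 2) (‖x‖ ^ 2) := by
    have h3 := Complex.hasSum_re (hb x x)
    rw [inner_self_eq_norm_sq_to_K] at h3
    convert h3 using 1
    · funext i
      rw [← inner_conj_symm (b i) x, RCLike.mul_conj]
      norm_cast
    · norm_cast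
  rw [← ofReal_norm x, ← ENNReal.ofReal_pow (norm_nonneg _), ← h2.tsum_eq,
    ENNReal.ofReal_tsum_of_nonneg (fun i => by positivity) h2.summable]
  refine tsum_congr fun i => ?_
  rw [← ofReal_norm, ← ENNReal.ofReal_pow (norm_nonneg _)]

end Frame

/-! ### Factorization of the kernel through its reproducing kernel Hilbert space. -/

section Factorization

variable {V : Type*} [NormedAddCommGroup V] [InnerProductSpace ℂ V] [CompleteSpace V]
  {X : Type*} [MeasurableSpace X] {χ : VectorMeasure X (V →L[ℂ] V)}
  {T : Type*} {f : T → X → ℂ}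

/-- The reproducing property gives `⟨k_a v, k_b v⟩ = ∫ f_a conj(f_b)` against `quadMeasure` at `v`;
expand the square. The cases `c = 1` and `c = 0` give distances and norms. -/
theorem enorm_sq_kerFun_sub (hT : IsTPlusMeasure χ) (hf : ∀ t, Measurable (f t))
    (hb : ∀ t, ∃ C, ∀ u, ‖f t u‖ ≤ C) [Fact (opKernel χ f).PosSemidef] (t s : T) (c : ℝ) (v : V) :
    ‖RKHS.kerFun (RKHS.OfKernel (opKernel χ f)) t v
        - (c : ℂ) • RKHS.kerFun (RKHS.OfKernel (opKernel χ f)) s v‖ₑ ^ 2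
      = ∫⁻ u, ‖f t u - c * f s u‖ₑ ^ 2 ∂quadMeasure (fun s hs => (hT s hs).1) v := by
  set hχ := fun s hs => (hT s hs).1
  set k := RKHS.kerFun (RKHS.OfKernel (opKernel χ f))
  choose C hC using hb
  have hm : ∀ a b, Measurable fun u => f a u * conj (f b u) := fun a b =>
    (hf a).mul (Complex.continuous_conj.measurable.comp (hf b))
  have hbd : ∀ a b u, ‖f a u * conj (f b u)‖ ≤ C a * C b := fun a b u => by
    rw [norm_mul, RCLike.norm_conj]
    exact mul_le_mul (hC a u) (hC b u) (norm_nonneg _) ((norm_nonneg _).trans (hC a u))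
  have hint : ∀ a b, Integrable (fun u => f a u * conj (f b u)) (quadMeasure hχ v) := fun a b =>
    Integrable.of_bound (hm a b).aestronglyMeasurable _ (.of_forall (hbd a b))
  have hk : ∀ a b, ⟪k a v, k b v⟫_ℂ = ∫ u, f a u * conj (f b u) ∂quadMeasure hχ v := by
    intro a b
    rw [← RKHS.kernel_inner, RKHS.OfKernel.kernel_ofKernel, ← inner_conj_symm]
    change conj ⟪v, opIntegral χ (fun u => f b u * conj (f a u)) v⟫_ℂ = _
    rw [inner_opIntegral hχ (integrable_variation hT (hm b a) (hbd b a)), ← integral_conj]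
    simp [mul_comm]
  have h1 : ((‖k t v - (c : ℂ) • k s v‖ ^ 2 : ℝ) : ℂ)
      = ∫ u, ((‖f t u - c * f s u‖ ^ 2 : ℝ) : ℂ) ∂quadMeasure hχ v := by
    have e : ∀ u, ((‖f t u - c * f s u‖ ^ 2 : ℝ) : ℂ) =
        (f t u * conj (f t u) - c * (f t u * conj (f s u))) -
          (c * (f s u * conj (f t u)) - c * (c * (f s u * conj (f s u)))) := by
      intro u
      rw [Complex.ofReal_pow, ← Complex.mul_conj']
      simp
      ring
    simp only [e]
    rw [integral_sub, integral_sub, integral_sub]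
    · simp only [integral_const_mul, ← hk]
      have := inner_self_eq_norm_sq_to_K (𝕜 := ℂ) (k t v - (c : ℂ) • k s v)
      rw [Complex.ofReal_pow]
      refine Eq.trans this.symm ?_
      simp only [inner_sub_left, inner_sub_right, inner_smul_left, inner_smul_right,
        Complex.conj_ofReal]
      ring
    · exact (hint s t).const_mul _
    · exact ((hint s s).const_mul _).const_mul _
    · exact hint t t
    · exact (hint t s).const_mul _
    · exact (hint t t).sub ((hint t s).const_mul _)
    · exact ((hint s t).const_mul _).sub (((hint s s).const_mul _).const_mul _)
  rw [integral_complex_ofReal] at h1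
  have h2 := Complex.ofReal_injective h1
  have hi2 : Integrable (fun u => ‖f t u - c * f s u‖ ^ 2) (quadMeasure hχ v) := by
    refine Integrable.of_bound (((hf t).sub ((hf s).const_mul _)).norm.pow_const 2
      |>.aestronglyMeasurable) ((C t + |c| * C s) ^ 2) (.of_forall fun u => ?_)
    rw [norm_pow, norm_norm]
    gcongr
    refine (norm_sub_le _ _).trans ?_
    rw [norm_mul, Complex.norm_real, Real.norm_eq_abs]
    gcongr
    exacts [hC t u, hC s u]
  rw [← ofReal_norm, ← ENNReal.ofReal_pow (norm_nonneg _), h2,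
    ofReal_integral_eq_lintegral_ofReal hi2 (.of_forall fun u => by positivity)]
  refine lintegral_congr fun u => ?_
  rw [ENNReal.ofReal_pow (norm_nonneg _), ofReal_norm]

theorem tendsto_lintegral_enorm_sub_sq [TopologicalSpace T] [FirstCountableTopology T]
    (μ : Measure X) [IsFiniteMeasure μ] (hf : ∀ t, Measurable (f t))
    (hb : ∀ t, ∃ C, ∀ᶠ s in 𝓝 t, ∀ u, ‖f s u‖ ≤ C) (hc : ∀ u, Continuous fun t => f t u) (t : T) :
    Tendsto (fun s => ∫⁻ u, ‖f s u - f t u‖ₑ ^ 2 ∂μ) (𝓝 t) (𝓝 0) := by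
  obtain ⟨C, hC⟩ := hb t
  have h0 : (0 : ℝ≥0∞) = ∫⁻ u, ‖f t u - f t u‖ₑ ^ 2 ∂μ := by simp
  rw [h0]
  refine tendsto_lintegral_filter_of_dominated_convergence
    (fun _ => ENNReal.ofReal ((2 * C) ^ 2)) ?_ ?_ ?_ ?_
  · exact .of_forall fun s => ((hf s).sub (hf t)).enorm.pow_const 2
  · filter_upwards [hC] with s hs
    refine .of_forall fun u => ?_
    rw [← ofReal_norm, ← ENNReal.ofReal_pow (norm_nonneg _)]
    refine ENNReal.ofReal_le_ofReal ?_
    gcongr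
    refine (norm_sub_le _ _).trans ?_
    linarith [hs u, hC.self_of_nhds u]
  · rw [lintegral_const]
    finiteness
  · refine .of_forall fun u => ?_
    have : Continuous fun s => ‖f s u - f t u‖ₑ ^ 2 :=
      (ENNReal.continuous_pow 2).comp (((hc u).sub continuous_const).enorm)
    exact this.tendsto t

/-- Take `p n t = b n t`, the value at `t` of the frame function `b n`. Since `⟨v, b n t⟩ = ⟨k_t v,
b n⟩`, expanding `⟨k_t x, k_s y⟩` in the frame gives the kernel, and `∑ ‖p n t‖²` is the integral of
`|f t|²` against the trace measure. Finiteness of that measure yields square summability and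
continuity. -/
theorem exists_factorization [TopologicalSpace T] [FirstCountableTopology T]
    [TopologicalSpace.SeparableSpace T] [TopologicalSpace.SeparableSpace V]
    (hT : IsTPlusMeasure χ) (hf : ∀ t, Measurable (f t))
    (hb : ∀ t, ∃ C, ∀ᶠ s in 𝓝 t, ∀ u, ‖f s u‖ ≤ C) (hc : ∀ u, Continuous fun t => f t u) :
    ∃ p : ℕ → T → V, (∀ t, ∑' n, ‖p n t‖ₑ ^ 2 ≠ ∞) ∧
      (∀ t, Tendsto (fun s => ∑' n, ‖p n s - p n t‖ₑ ^ 2) (𝓝 t) (𝓝 0)) ∧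
      ∀ t s x y, HasSum (fun n => ⟪x, p n t⟫_ℂ * ⟪p n s, y⟫_ℂ)
        ⟪x, opIntegral χ (fun u => f t u * conj (f s u)) y⟫_ℂ := by
  have hb' : ∀ t, ∃ C, ∀ u, ‖f t u‖ ≤ C := fun t => (hb t).imp fun C hC => hC.self_of_nhds
  have : Fact (opKernel χ f).PosSemidef := ⟨posSemidef_opKernel hT hf hb'⟩
  have hχ := fun s hs => (hT s hs).1
  obtain ⟨w, e, -⟩ := exists_hilbertBasis ℂ V
  have hτ := isFiniteMeasure_traceMeasure e hT
  set k := RKHS.kerFun (RKHS.OfKernel (opKernel χ f)) with hk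
  have hsub : ∀ t s v, ‖k t v - k s v‖ₑ ^ 2 = ∫⁻ u, ‖f t u - f s u‖ₑ ^ 2 ∂quadMeasure hχ v := by
    intro t s v
    simpa using enorm_sq_kerFun_sub hT hf hb' t s 1 v
  have hself : ∀ t v, ‖k t v‖ₑ ^ 2 = ∫⁻ u, ‖f t u‖ₑ ^ 2 ∂quadMeasure hχ v := by
    intro t v
    simpa using enorm_sq_kerFun_sub hT hf hb' t t 0 v
  have hcont : ∀ v, Continuous fun t => k t v := by
    intro v
    refine continuous_iff_continuousAt.2 fun t => tendsto_iff_edist_tendsto_0.2 ?_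
    have h := tendsto_lintegral_enorm_sub_sq (quadMeasure hχ v) hf hb hc t
    simp only [← hsub] at h
    have h2 := (ENNReal.continuous_rpow_const (y := 1 / 2)).tendsto 0 |>.comp h
    simp only [Function.comp_def, one_div, ← ENNReal.rpow_natCast, ← ENNReal.rpow_mul] at h2
    simpa [edist_eq_enorm_sub] using h2
  -- As `k t v` is continuous in `t` and in `v`, kernel functions at a countable dense set of points
  -- already approximate all of them, and these span a dense subspace.
  have hsep : TopologicalSpace.SeparableSpace (RKHS.OfKernel (opKernel χ f)) := by
    obtain ⟨D, hDc, hDd⟩ := TopologicalSpace.exists_countable_dense T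
    have h1 : TopologicalSpace.IsSeparable (⋃ t : D, Set.range (k t)) := by
      have := hDc.to_subtype
      exact .iUnion fun t => TopologicalSpace.isSeparable_range (k t).continuous
    have h2 : {g | ∃ t v, k t v = g} ⊆ closure (⋃ t : D, Set.range (k t)) := by
      rintro _ ⟨t, v, rfl⟩
      have := (hcont v).range_subset_closure_image_dense hDd ⟨t, rfl⟩
      refine closure_mono ?_ this
      rintro _ ⟨t', ht', rfl⟩
      exact Set.mem_iUnion.2 ⟨⟨t', ht'⟩, v, rfl⟩
    have h3 := ((h1.closure.mono h2).span (R := ℂ)).closure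
    have h4 := RKHS.kerFun_dense (RKHS.OfKernel (opKernel χ f))
    have h5 := congrArg (fun S : Submodule ℂ _ => (S : Set (RKHS.OfKernel (opKernel χ f)))) h4
    simp only [Submodule.topologicalClosure_coe, Submodule.top_coe] at h5
    rw [h5] at h3
    exact TopologicalSpace.isSeparable_univ_iff.1 h3
  obtain ⟨b, hb⟩ := exists_parseval_frame (E := RKHS.OfKernel (opKernel χ f))
  have hin : ∀ n t v, ⟪v, (b n) t⟫_ℂ = ⟪k t v, b n⟫_ℂ := fun n t v => (RKHS.kerFun_inner ..).symm
  have hswap : ∀ g : V → RKHS.OfKernel (opKernel χ f),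
      ∑' n, ∑' j, ‖⟪g (e j), b n⟫_ℂ‖ₑ ^ 2 = ∑' j, ‖g (e j)‖ₑ ^ 2 := by
    intro g
    rw [ENNReal.tsum_comm]
    exact tsum_congr fun j => tsum_enorm_inner_sq_of_frame hb _
  refine ⟨fun n t => b n t, fun t => ?_, fun t => ?_, fun t s x y => ?_⟩
  · have : ∑' n, ‖(b n) t‖ₑ ^ 2 = ∫⁻ u, ‖f t u‖ₑ ^ 2 ∂traceMeasure e hχ := by
      simp only [parseval_enorm e, hin]
      rw [hswap, traceMeasure, lintegral_sum_measure]
      simp only [hself]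
    rw [this]
    obtain ⟨C, hC⟩ := hb' t
    refine ne_top_of_le_ne_top ?_ (lintegral_mono (g := fun _ => ENNReal.ofReal (C ^ 2)) fun u => ?_)
    · rw [lintegral_const]
      finiteness
    · rw [← ofReal_norm, ← ENNReal.ofReal_pow (norm_nonneg _)]
      exact ENNReal.ofReal_le_ofReal (by gcongr; exact hC u)
  · have : ∀ s, ∑' n, ‖(b n) s - (b n) t‖ₑ ^ 2 =
        ∫⁻ u, ‖f s u - f t u‖ₑ ^ 2 ∂traceMeasure e hχ := by
      intro s
      simp only [parseval_enorm e, inner_sub_right, hin, ← inner_sub_left]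
      rw [hswap fun v => k s v - k t v, traceMeasure, lintegral_sum_measure]
      simp only [hsub]
    simp only [this]
    exact tendsto_lintegral_enorm_sub_sq _ hf ‹_› hc t
  · have h := hb (k t x) (k s y)
    simp only [hin]
    have h1 : ⟪k t x, k s y⟫_ℂ = ⟪x, opIntegral χ (fun u => f t u * conj (f s u)) y⟫_ℂ := by
      have h2 := RKHS.kernel_inner (RKHS.OfKernel (opKernel χ f)) t s y x
      rw [RKHS.OfKernel.kernel_ofKernel] at h2
      rw [← inner_conj_symm, ← h2, inner_conj_symm]
      rfl
    rw [← h1]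
    convert h using 2 with n
    rw [← inner_conj_symm ((b n) s), hin, inner_conj_symm]

end Factorization

/-! ### A discrete random field with prescribed covariance. -/

section RandomSeries

/-- The sample space `ℕ × Bool`, in an arbitrary universe. -/
abbrev SignSpace : Type w := ULift.{w} (ℕ × Bool)

noncomputable instance : MeasurableSpace SignSpace.{w} := ⊤

instance : DiscreteMeasurableSpace SignSpace.{w} := ⟨fun _ => trivial⟩

/-- A geometric variable together with an independent random sign. -/
noncomputable def signMeasure : Measure SignSpace.{w} :=
  Measure.sum fun q : ℕ × Bool => ((2⁻¹ : ℝ≥0∞) ^ (q.1 + 1) * 2⁻¹) • Measure.dirac (ULift.up q)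

theorem lintegral_signMeasure (F : SignSpace.{w} → ℝ≥0∞) :
    ∫⁻ ω, F ω ∂signMeasure = ∑' n : ℕ, (2⁻¹ : ℝ≥0∞) ^ (n + 1) *
      (2⁻¹ * (F ⟨n, true⟩ + F ⟨n, false⟩)) := by
  rw [signMeasure, lintegral_sum_measure]
  simp only [lintegral_smul_measure, lintegral_dirac, smul_eq_mul]
  rw [ENNReal.tsum_prod']
  refine tsum_congr fun n => ?_
  rw [tsum_fintype, Fintype.sum_bool]
  ring

instance : IsProbabilityMeasure signMeasure.{w} := ⟨by
  have h := lintegral_signMeasure.{w} fun _ => 1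
  rw [lintegral_one] at h
  rw [h, one_add_one_eq_two, ENNReal.inv_mul_cancel (by simp) (by simp)]
  simp only [mul_one]
  rw [ENNReal.tsum_geometric_add_one, ENNReal.one_sub_inv_two, inv_inv,
    ENNReal.inv_mul_cancel (by simp) (by simp)]⟩

theorem hasSum_signMeasure {G : Type*} [NormedAddCommGroup G] [NormedSpace ℝ G] [CompleteSpace G]
    {F : SignSpace.{w} → G} (hF : Integrable F signMeasure) :
    HasSum (fun q : ℕ × Bool => ((2⁻¹ : ℝ) ^ (q.1 + 1) * 2⁻¹) • F ⟨q⟩) (∫ ω, F ω ∂signMeasure) := by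
  have h := hasSum_integral_measure hF
  refine h.congr_fun fun q => ?_
  rw [integral_smul_measure, integral_dirac]
  simp

variable {V : Type*} [NormedAddCommGroup V] [InnerProductSpace ℂ V] {T : Type*}

/-- The random field `± 2 ^ ((n + 1) / 2) • p n t`. -/
noncomputable def signField (p : ℕ → T → V) (t : T) (ω : SignSpace.{w}) : V :=
  ((if ω.down.2 then 1 else -1 : ℝ) * √(2 ^ (ω.down.1 + 1))) • p ω.down.1 t

/-- The squared factor `2^(n+1)` cancels the probability `2^(-n-1)` of drawing `n`. -/
theorem lintegral_enorm_signField_sq (p : ℕ → T → V) (t : T) :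
    ∫⁻ ω, ‖signField.{w} p t ω‖ₑ ^ 2 ∂signMeasure = ∑' n, ‖p n t‖ₑ ^ 2 := by
  rw [lintegral_signMeasure]
  refine tsum_congr fun n => ?_
  have hs : ‖√(2 ^ (n + 1) : ℝ)‖ₑ ^ 2 = 2 ^ (n + 1) := by
    rw [← ofReal_norm, Real.norm_of_nonneg (Real.sqrt_nonneg _),
      ← ENNReal.ofReal_pow (Real.sqrt_nonneg _), Real.sq_sqrt (by positivity),
      ENNReal.ofReal_pow (by norm_num)]
    norm_num
  simp only [signField, enorm_smul, if_true, Bool.false_eq_true, if_false, one_mul, neg_one_mul,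
    enorm_neg, mul_pow, hs]
  rw [← two_mul, ← mul_assoc 2⁻¹ 2, ENNReal.inv_mul_cancel (by simp) (by simp), one_mul,
    ← mul_assoc, ← mul_pow, ENNReal.inv_mul_cancel (by simp) (by simp), one_pow, one_mul]

theorem signField_sub (p : ℕ → T → V) (t s : T) :
    signField.{w} p s - signField p t = fun ω => signField (fun n (_ : Unit) => p n s - p n t) () ω := by
  funext ω
  simp [signField, smul_sub]

theorem memLp_signField {p : ℕ → T → V} {t : T} (h : ∑' n, ‖p n t‖ₑ ^ 2 ≠ ∞) :
    MemLp (signField.{w} p t) 2 signMeasure := by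
  refine ⟨.of_discrete, ?_⟩
  have h2 := eLpNorm_nnreal_pow_eq_lintegral (f := signField.{w} p t) (μ := signMeasure)
    (p := 2) (by simp)
  simp only [NNReal.coe_ofNat, ENNReal.coe_ofNat, ENNReal.rpow_ofNat] at h2
  rw [lintegral_enorm_signField_sq] at h2
  refine lt_top_iff_ne_top.2 fun h3 => h ?_
  rw [← h2, h3]
  simp

theorem eLpNorm_signField_sub_sq (p : ℕ → T → V) (t s : T) :
    eLpNorm (signField.{w} p s - signField p t) 2 signMeasure ^ 2
      = ∑' n, ‖p n s - p n t‖ₑ ^ 2 := by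
  have h2 := eLpNorm_nnreal_pow_eq_lintegral (f := signField.{w} p s - signField p t)
    (μ := signMeasure) (p := 2) (by simp)
  simp only [NNReal.coe_ofNat, ENNReal.coe_ofNat, ENNReal.rpow_ofNat] at h2
  rw [h2, signField_sub, lintegral_enorm_signField_sq]

/-- Flipping the sign permutes the terms of the expectation and negates each, so the expectation
equals its own negative. -/
theorem integral_signField [CompleteSpace V] {p : ℕ → T → V} {t : T}
    (h : ∑' n, ‖p n t‖ₑ ^ 2 ≠ ∞) : ∫ ω, signField.{w} p t ω ∂signMeasure = 0 := by
  have h1 := hasSum_signMeasure ((memLp_signField.{w} h).integrable (by norm_num))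
  have h2 := ((Equiv.refl ℕ).prodCongr Equiv.boolNot).hasSum_iff.2 h1
  have h3 := h1.neg
  have e : (fun q : ℕ × Bool => -(((2⁻¹ : ℝ) ^ (q.1 + 1) * 2⁻¹) • signField.{w} p t ⟨q⟩)) =
      (fun q : ℕ × Bool => ((2⁻¹ : ℝ) ^ (q.1 + 1) * 2⁻¹) • signField.{w} p t ⟨q⟩) ∘
        ((Equiv.refl ℕ).prodCongr Equiv.boolNot) := by
    funext ⟨n, b⟩
    cases b <;> simp [signField]
  rw [e] at h3
  have h4 := add_eq_zero_iff_eq_neg.2 (h2.unique h3)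
  rw [← two_smul ℝ] at h4
  exact (smul_eq_zero.1 h4).resolve_left two_ne_zero

theorem integrable_rankOne {Ω : Type*} [MeasurableSpace Ω] [Countable Ω]
    [MeasurableSingletonClass Ω] {P : Measure Ω} {X Z : Ω → V}
    (hX : MemLp X 2 P) (hZ : MemLp Z 2 P) :
    Integrable (fun ω => InnerProductSpace.rankOne ℂ (X ω) (Z ω)) P := by
  have hn := hX.norm.integrable_mul hZ.norm
  exact hn.mono' .of_discrete (.of_forall fun ω => by simp)

/-- Only one index `n` is drawn at a time, so no products `p n t ⊗ p m s` with `n ≠ m` appear; the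
two signs contribute half each. -/
theorem inner_crossCov_signField [CompleteSpace V] {p : ℕ → T → V}
    (h : ∀ t, ∑' n, ‖p n t‖ₑ ^ 2 ≠ ∞) (t s : T) (x y : V) {z : ℂ}
    (hz : HasSum (fun n => ⟪x, p n t⟫_ℂ * ⟪p n s, y⟫_ℂ) z) :
    ⟪x, crossCov signMeasure.{w} (signField p t) (signField p s) y⟫_ℂ = z := by
  have h1 := hasSum_inner_apply (hasSum_signMeasure (integrable_rankOne
    (memLp_signField.{w} (h t)) (memLp_signField.{w} (h s)))) x y
  have e : ∀ n b, ⟪x, (((2⁻¹ : ℝ) ^ (n + 1) * 2⁻¹) • InnerProductSpace.rankOne ℂ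
      (signField.{w} p t ⟨(n, b)⟩) (signField.{w} p s ⟨(n, b)⟩)) y⟫_ℂ =
      2⁻¹ * (⟪x, p n t⟫_ℂ * ⟪p n s, y⟫_ℂ) := by
    intro n b
    have hs : ((√(2 ^ (n + 1) : ℝ) : ℝ) : ℂ) * (√(2 ^ (n + 1) : ℝ) : ℝ) = 2 ^ (n + 1) := by
      rw [← Complex.ofReal_mul, Real.mul_self_sqrt (by positivity)]
      norm_cast
    rw [smul_apply, InnerProductSpace.rankOne_apply, RCLike.real_smul_eq_coe_smul (K := ℂ),
      inner_smul_right, inner_smul_right]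
    simp only [signField]
    rw [RCLike.real_smul_eq_coe_smul (K := ℂ), RCLike.real_smul_eq_coe_smul (K := ℂ),
      inner_smul_left, inner_smul_right]
    have h4 : (((2 : ℝ)⁻¹ ^ (n + 1) : ℝ) : ℂ) * 2 ^ (n + 1) = 1 := by
      push_cast
      rw [← mul_pow, inv_mul_cancel₀ (by norm_num), one_pow]
    generalize (2 : ℝ)⁻¹ ^ (n + 1) = a at *
    cases b <;> simp <;> linear_combination (2⁻¹ * ⟪x, p n t⟫_ℂ * ⟪p n s, y⟫_ℂ) *
      (a * hs + h4)
  have h2 := h1.prod_fiberwise fun n => hasSum_fintype _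
  refine h2.unique (hz.congr_fun fun n => ?_)
  rw [Fintype.sum_bool, e, e]
  ring

end RandomSeries

/-! ### Weighted Taylor remainders of the exponential. -/

section Taylor

variable {d : ℕ}

/-- `(exp(i uᵀt) - 1_{‖u‖ < 1} P(uᵀt)) / (1 ∧ ‖u‖ ^ n)`, with `P` the Taylor polynomial of
`exp(i ·)` with `n` terms. -/
noncomputable def expRemainder (n : ℕ) (t u : EuclideanSpace ℝ (Fin d)) : ℂ :=
  (Complex.exp (Complex.I * (⟪u, t⟫_ℝ : ℝ)) -
    (Metric.ball 0 1).indicator (fun u => ∑ j ∈ Finset.range n,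
      (Complex.I * (⟪u, t⟫_ℝ : ℝ)) ^ j / (j.factorial : ℂ)) u) / ((min 1 (‖u‖ ^ n) : ℝ) : ℂ)

theorem measurable_expRemainder (n : ℕ) (t : EuclideanSpace ℝ (Fin d)) :
    Measurable (expRemainder n t) := by
  unfold expRemainder
  refine Measurable.div (Measurable.sub ?_ (Measurable.indicator ?_ measurableSet_ball)) ?_
  · exact Continuous.measurable (by fun_prop)
  · exact Continuous.measurable (by fun_prop)
  · exact Continuous.measurable (by fun_prop)

theorem continuous_expRemainder (n : ℕ) (u : EuclideanSpace ℝ (Fin d)) :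
    Continuous fun t => expRemainder n t u := by
  unfold expRemainder
  by_cases hu : u ∈ Metric.ball (0 : EuclideanSpace ℝ (Fin d)) 1
  · simp only [Set.indicator_of_mem hu]
    fun_prop
  · simp only [Set.indicator_of_notMem hu]
    fun_prop

/-- Inside the unit ball the remainder is of order `‖u‖ ^ n`, which pays for the denominator;
outside, no polynomial is subtracted and the exponential has modulus `1`. -/
theorem norm_expRemainder_le (n : ℕ) (t u : EuclideanSpace ℝ (Fin d)) :
    ‖expRemainder n t u‖ ≤ ‖t‖ ^ n * Real.exp ‖t‖ + 1 := by
  have h0 : 0 ≤ ‖t‖ ^ n * Real.exp ‖t‖ := by positivity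
  unfold expRemainder
  rw [norm_div, Complex.norm_real]
  by_cases hu : u ∈ Metric.ball (0 : EuclideanSpace ℝ (Fin d)) 1
  · rw [Set.indicator_of_mem hu]
    have hu1 : ‖u‖ < 1 := by simpa using hu
    rw [min_eq_right (pow_le_one₀ (norm_nonneg _) hu1.le), Real.norm_of_nonneg (by positivity)]
    have h1 := Complex.norm_exp_sub_sum_le_norm_mul_exp (Complex.I * (⟪u, t⟫_ℝ : ℝ)) n
    have h2 : ‖Complex.I * ((⟪u, t⟫_ℝ : ℝ) : ℂ)‖ ≤ ‖u‖ * ‖t‖ := by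
      rw [norm_mul, Complex.norm_I, one_mul, Complex.norm_real]
      exact norm_inner_le_norm _ _
    have h3 : ‖u‖ * ‖t‖ ≤ ‖t‖ := mul_le_of_le_one_left (norm_nonneg _) hu1.le
    -- This also covers `u = 0` with `n > 0`, where the quotient by zero is `0`.
    refine (div_le_of_le_mul₀ (by positivity) h0 (h1.trans ?_)).trans (by linarith)
    calc _ ≤ (‖u‖ * ‖t‖) ^ n * Real.exp ‖t‖ := by
          gcongr
          exact h2.trans h3
      _ = _ := by ring
  · rw [Set.indicator_of_notMem hu]
    have hu1 : 1 ≤ ‖u‖ := by simpa using hu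
    rw [min_eq_left (one_le_pow₀ hu1), sub_zero, mul_comm, Complex.norm_exp_ofReal_mul_I]
    simpa using h0

theorem expRemainder_bounded (n : ℕ) (t : EuclideanSpace ℝ (Fin d)) :
    ∃ C, ∀ᶠ s in 𝓝 t, ∀ u, ‖expRemainder n s u‖ ≤ C := by
  have hc : Continuous fun s : EuclideanSpace ℝ (Fin d) => ‖s‖ ^ n * Real.exp ‖s‖ + 1 := by fun_prop
  refine ⟨‖t‖ ^ n * Real.exp ‖t‖ + 1 + 1, ?_⟩
  filter_upwards [(hc.tendsto t).eventually_lt_const (lt_add_one _)] with s hs u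
  exact (norm_expRemainder_le n s u).trans hs.le

end Taylor

/-! ### Fourier transforms of measures in `Lam d k` and cancellation of Taylor terms. -/

section Fourier

variable {d : ℕ} {k : ℤ}

/-- The Fourier transform of a finitely supported measure. -/
noncomputable def fourier (l : FinMeas d) (u : EuclideanSpace ℝ (Fin d)) : ℂ :=
  l.sum fun t c => c * Complex.exp (Complex.I * (⟪u, t⟫_ℝ : ℝ))

theorem continuous_fourier (l : FinMeas d) : Continuous (fourier l) := by
  unfold fourier Finsupp.sum
  fun_prop

theorem fourier_translate (w : EuclideanSpace ℝ (Fin d)) (l : Lam d k)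
    (u : EuclideanSpace ℝ (Fin d)) :
    fourier (translate w l).1 u = Complex.exp (Complex.I * (⟪u, w⟫_ℝ : ℝ)) * fourier l.1 u := by
  unfold fourier translate
  rw [Finsupp.sum_mapDomain_index (by simp) (by intros; ring), Finsupp.mul_sum]
  refine Finsupp.sum_congr fun t _ => ?_
  rw [inner_add_right, Complex.ofReal_add, mul_add, Complex.exp_add]
  ring

theorem fourier_dilate (c : ℝ) (l : Lam d k) (u : EuclideanSpace ℝ (Fin d)) :
    fourier (dilate c l).1 u = fourier l.1 (c • u) := by
  unfold fourier dilate
  rw [Finsupp.sum_mapDomain_index (by simp) (by intros; ring)]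
  refine Finsupp.sum_congr fun t _ => ?_
  rw [inner_smul_left, inner_smul_right]
  simp

theorem sum_inner_pow_eq_zero {l : FinMeas d} (hl : l ∈ Lam d k) {j : ℕ} (hj : (j : ℤ) ≤ k)
    (u : EuclideanSpace ℝ (Fin d)) : (l.sum fun t c => c * ((⟪u, t⟫_ℝ : ℝ) : ℂ) ^ j) = 0 := by
  let q : MvPolynomial (Fin d) ℂ :=
    (∑ i, MvPolynomial.C (u i : ℂ) * MvPolynomial.X i) ^ j
  have hq : q.totalDegree ≤ j := by
    refine (MvPolynomial.totalDegree_pow _ _).trans ?_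
    refine (Nat.mul_le_mul_left j (MvPolynomial.totalDegree_finsetSum_le (d := 1)
      fun i _ => ?_)).trans (by simp)
    exact (MvPolynomial.totalDegree_mul _ _).trans (by simp)
  rw [← hl q (by omega)]
  refine Finsupp.sum_congr fun t _ => ?_
  congr 1
  simp only [q, map_pow, map_sum, map_mul, MvPolynomial.eval_C, MvPolynomial.eval_X]
  congr 1
  rw [PiLp.inner_apply]
  push_cast
  refine Finset.sum_congr rfl fun i _ => ?_
  simp [mul_comm]

theorem sum_expRemainder {n : ℕ} {l : FinMeas d} (hl : l ∈ Lam d (n - 1))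
    (u : EuclideanSpace ℝ (Fin d)) :
    (l.sum fun t c => c * expRemainder n t u) = fourier l u / ((min 1 (‖u‖ ^ n) : ℝ) : ℂ) := by
  unfold expRemainder fourier
  simp only [mul_div_assoc', mul_sub]
  rw [div_eq_mul_inv, Finsupp.sum_mul]
  simp only [← div_eq_mul_inv, sub_div]
  rw [Finsupp.sum_sub, sub_eq_self]
  by_cases hu : u ∈ Metric.ball (0 : EuclideanSpace ℝ (Fin d)) 1
  · simp only [Set.indicator_of_mem hu, div_eq_mul_inv]
    rw [← Finsupp.sum_mul]
    have : (l.sum fun t c => c * ∑ j ∈ Finset.range n,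
        (Complex.I * (⟪u, t⟫_ℝ : ℝ)) ^ j * (j.factorial : ℂ)⁻¹) = 0 := by
      simp only [Finset.mul_sum]
      unfold Finsupp.sum
      rw [Finset.sum_comm]
      refine Finset.sum_eq_zero fun j hj => ?_
      have h := sum_inner_pow_eq_zero hl (j := j) (by have := Finset.mem_range.1 hj; omega) u
      have e : ∀ t, l t * ((Complex.I * (⟪u, t⟫_ℝ : ℝ)) ^ j * (j.factorial : ℂ)⁻¹) =
          (Complex.I ^ j * (j.factorial : ℂ)⁻¹) * (l t * ((⟪u, t⟫_ℝ : ℝ) : ℂ) ^ j) := by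
        intro t
        ring
      simp only [e]
      rw [← Finset.mul_sum]
      exact mul_eq_zero_of_right _ h
    rw [this, zero_mul]
  · simp [Set.indicator_of_notMem hu]

/-- All `2n` Taylor terms cancel although `l` and `m` only annihilate degrees below `n`: in the
binomial expansion of `(uᵀt - uᵀs)^j` with `j < 2n`, each term has degree below `n` in `t` or in
`s`. -/
theorem sum_sum_expRemainder {n : ℕ} {l m : FinMeas d} (hl : l ∈ Lam d (n - 1))
    (hm : m ∈ Lam d (n - 1)) (u : EuclideanSpace ℝ (Fin d)) :
    (l.sum fun t a => m.sum fun s b => (a * conj b) * expRemainder (2 * n) (t - s) u) =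
      fourier l u * conj (fourier m u) / ((min 1 (‖u‖ ^ (2 * n)) : ℝ) : ℂ) := by
  have hexp : ∀ t s : EuclideanSpace ℝ (Fin d), Complex.exp (Complex.I * (⟪u, t - s⟫_ℝ : ℝ)) =
      Complex.exp (Complex.I * (⟪u, t⟫_ℝ : ℝ)) * conj (Complex.exp (Complex.I * (⟪u, s⟫_ℝ : ℝ))) := by
    intro t s
    rw [← Complex.exp_conj, ← Complex.exp_add, inner_sub_right]
    congr 1
    simp
    ring
  have hpow : ∀ j < 2 * n, (∑ t ∈ l.support, ∑ s ∈ m.support,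
      (l t * conj (m s)) * ((⟪u, t - s⟫_ℝ : ℝ) : ℂ) ^ j) = 0 := by
    intro j hj
    have e : ∀ t s, (l t * conj (m s)) * ((⟪u, t - s⟫_ℝ : ℝ) : ℂ) ^ j =
        ∑ a ∈ Finset.range (j + 1), ((-1) ^ (j - a) * (j.choose a : ℂ)) *
          ((l t * ((⟪u, t⟫_ℝ : ℝ) : ℂ) ^ a) *
            conj (m s * ((⟪u, s⟫_ℝ : ℝ) : ℂ) ^ (j - a))) := by
      intro t s
      rw [inner_sub_right, Complex.ofReal_sub, sub_eq_add_neg, add_pow, Finset.mul_sum]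
      refine Finset.sum_congr rfl fun a _ => ?_
      rw [neg_pow]
      simp
      ring
    simp only [e]
    have e2 : ∀ t, (∑ s ∈ m.support, ∑ a ∈ Finset.range (j + 1),
        ((-1) ^ (j - a) * (j.choose a : ℂ)) * ((l t * ((⟪u, t⟫_ℝ : ℝ) : ℂ) ^ a) *
            conj (m s * ((⟪u, s⟫_ℝ : ℝ) : ℂ) ^ (j - a)))) =
        ∑ a ∈ Finset.range (j + 1), (l t * ((⟪u, t⟫_ℝ : ℝ) : ℂ) ^ a) *
          (((-1) ^ (j - a) * (j.choose a : ℂ)) *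
            conj (∑ s ∈ m.support, m s * ((⟪u, s⟫_ℝ : ℝ) : ℂ) ^ (j - a))) := by
      intro t
      rw [Finset.sum_comm]
      refine Finset.sum_congr rfl fun a _ => ?_
      rw [map_sum, Finset.mul_sum, Finset.mul_sum]
      refine Finset.sum_congr rfl fun s _ => by ring
    simp only [e2]
    rw [Finset.sum_comm]
    refine Finset.sum_eq_zero fun a ha => ?_
    rw [← Finset.sum_mul]
    have ha' := Finset.mem_range.1 ha
    rcases lt_or_ge a n with h | h
    · have := sum_inner_pow_eq_zero hl (j := a) (by omega) u
      exact mul_eq_zero_of_left this _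
    · have := sum_inner_pow_eq_zero hm (j := j - a) (by omega) u
      rw [Finsupp.sum] at this
      rw [this, map_zero, mul_zero, mul_zero]
  unfold expRemainder
  simp only [Finsupp.sum, hexp, div_eq_mul_inv, ← mul_assoc _ (_ - _) _, ← Finset.sum_mul]
  congr 1
  simp only [mul_sub, Finset.sum_sub_distrib]
  have hmain : fourier l u * conj (fourier m u) = ∑ t ∈ l.support, ∑ s ∈ m.support,
      l t * conj (m s) * (Complex.exp (Complex.I * (⟪u, t⟫_ℝ : ℝ)) *
        conj (Complex.exp (Complex.I * (⟪u, s⟫_ℝ : ℝ)))) := by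
    unfold fourier Finsupp.sum
    rw [map_sum, Finset.sum_mul_sum]
    refine Finset.sum_congr rfl fun t _ => Finset.sum_congr rfl fun s _ => ?_
    rw [map_mul]
    ring
  rw [hmain, sub_eq_self]
  by_cases hu : u ∈ Metric.ball (0 : EuclideanSpace ℝ (Fin d)) 1
  · simp only [Set.indicator_of_mem hu, Finset.mul_sum]
    have e3 : ∀ t, (∑ s ∈ m.support, ∑ j ∈ Finset.range (2 * n), l t * conj (m s) *
        ((Complex.I * (⟪u, t - s⟫_ℝ : ℝ)) ^ j * (j.factorial : ℂ)⁻¹)) =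
        ∑ j ∈ Finset.range (2 * n), ∑ s ∈ m.support, (Complex.I ^ j * (j.factorial : ℂ)⁻¹) *
          (l t * conj (m s) * ((⟪u, t - s⟫_ℝ : ℝ) : ℂ) ^ j) := by
      intro t
      rw [Finset.sum_comm]
      refine Finset.sum_congr rfl fun a _ => Finset.sum_congr rfl fun s _ => by ring
    simp only [e3]
    rw [Finset.sum_comm]
    refine Finset.sum_eq_zero fun j hj => ?_
    simp only [← Finset.mul_sum]
    rw [hpow j (Finset.mem_range.1 hj), mul_zero]
  · simp [Set.indicator_of_notMem hu]

end Fourier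

/-! ### Cross-covariances under linear operations. -/

section CrossCov

variable {V : Type*} [NormedAddCommGroup V] [InnerProductSpace ℂ V] [CompleteSpace V]
  {Ω : Type*} [MeasurableSpace Ω] {P : Measure Ω}

theorem crossCov_sum {ι : Type*} (s r : Finset ι) (a b : ι → ℂ) {X Z : ι → Ω → V}
    (h : ∀ i j, Integrable (fun ω => InnerProductSpace.rankOne ℂ (X i ω) (Z j ω)) P) :
    crossCov P (fun ω => ∑ i ∈ s, a i • X i ω) (fun ω => ∑ j ∈ r, b j • Z j ω) =
      ∑ i ∈ s, ∑ j ∈ r, (a i * conj (b j)) • crossCov P (X i) (Z j) := by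
  unfold crossCov
  have e : ∀ ω, InnerProductSpace.rankOne ℂ (∑ i ∈ s, a i • X i ω) (∑ j ∈ r, b j • Z j ω) =
      ∑ i ∈ s, ∑ j ∈ r, (a i * conj (b j)) • InnerProductSpace.rankOne ℂ (X i ω) (Z j ω) := by
    intro ω
    ext z
    simp only [InnerProductSpace.rankOne_apply, sum_apply, smul_apply, sum_inner,
      inner_smul_left, Finset.smul_sum, smul_smul]
    refine Finset.sum_congr rfl fun i _ => ?_
    rw [Finset.sum_mul, Finset.sum_smul]
    refine Finset.sum_congr rfl fun j _ => ?_
    congr 1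
    ring
  simp only [e]
  rw [integral_finsetSum _ fun i _ => integrable_finsetSum _ fun j _ => (h i j).fun_smul _]
  refine Finset.sum_congr rfl fun i _ => ?_
  rw [integral_finsetSum _ fun j _ => (h i j).fun_smul _]
  exact Finset.sum_congr rfl fun j _ => integral_smul _ _

theorem crossCov_map (A : V →L[ℂ] V) {X Z : Ω → V}
    (h : Integrable (fun ω => InnerProductSpace.rankOne ℂ (X ω) (Z ω)) P) :
    crossCov P (fun ω => A (X ω)) (fun ω => A (Z ω)) =
      A * crossCov P X Z * ContinuousLinearMap.adjoint A := by
  unfold crossCov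
  have e : ∀ ω, InnerProductSpace.rankOne ℂ (A (X ω)) (A (Z ω)) =
      ((ContinuousLinearMap.mul ℂ (V →L[ℂ] V)).flip (ContinuousLinearMap.adjoint A) ∘L
        ContinuousLinearMap.mul ℂ (V →L[ℂ] V) A) (InnerProductSpace.rankOne ℂ (X ω) (Z ω)) := by
    intro ω
    ext z
    simp [InnerProductSpace.rankOne_apply, ContinuousLinearMap.adjoint_inner_right]
  simp only [e]
  rw [ContinuousLinearMap.integral_comp_comm _ h]
  simp

end CrossCov

/-! ### Intrinsic random functions with a given spectral measure. -/

section Spectral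

variable {V : Type*} [NormedAddCommGroup V] [InnerProductSpace ℂ V] [CompleteSpace V]

theorem sum_sum_smul_opIntegral {X : Type*} [MeasurableSpace X] {χ : VectorMeasure X (V →L[ℂ] V)}
    (hT : IsTPlusMeasure χ) {d : ℕ} (l m : FinMeas d)
    {g : EuclideanSpace ℝ (Fin d) → EuclideanSpace ℝ (Fin d) → X → ℂ}
    (hg : ∀ t s, Measurable (g t s)) (hb : ∀ t s, ∃ C, ∀ u, ‖g t s u‖ ≤ C) :
    (l.sum fun t a => m.sum fun s b => (a * conj b) • opIntegral χ (g t s)) =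
      opIntegral χ fun u => l.sum fun t a => m.sum fun s b => (a * conj b) * g t s u := by
  have hχ := fun s hs => (hT s hs).1
  have hi : ∀ t s, Integrable (g t s) χ.variation := fun t s => by
    obtain ⟨C, hC⟩ := hb t s
    exact integrable_variation hT (hg t s) hC
  have hi2 : ∀ x t s, Integrable (g t s) (quadMeasure hχ x) := fun x t s => by
    obtain ⟨C, hC⟩ := hb t s
    exact Integrable.of_bound (hg t s).aestronglyMeasurable C (.of_forall hC)
  refine ext_quadratic fun x => ?_
  unfold Finsupp.sum
  rw [inner_opIntegral hχ (integrable_finsetSum _ fun t _ => integrable_finsetSum _ fun s _ =>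
    (hi t s).const_mul _), integral_finsetSum _ fun t _ => integrable_finsetSum _ fun s _ =>
    (hi2 x t s).const_mul _, sum_apply, inner_sum]
  refine Finset.sum_congr rfl fun t _ => ?_
  rw [integral_finsetSum _ fun s _ => (hi2 x t s).const_mul _, sum_apply, inner_sum]
  refine Finset.sum_congr rfl fun s _ => ?_
  rw [smul_apply, inner_smul_right, inner_opIntegral hχ (hi t s), integral_const_mul]

variable {d : ℕ} {χ : VectorMeasure (EuclideanSpace ℝ (Fin d)) (V →L[ℂ] V)}

/-- The covariance operator `∫ l̂(u) conj(m̂(u)) / (1 ∧ ‖u‖ ^ (2n)) χ(du)`. -/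
noncomputable def spectralCov (χ : VectorMeasure (EuclideanSpace ℝ (Fin d)) (V →L[ℂ] V)) (n : ℕ)
    (l m : FinMeas d) : V →L[ℂ] V :=
  opIntegral χ fun u => fourier l u * conj (fourier m u) / ((min 1 (‖u‖ ^ (2 * n)) : ℝ) : ℂ)

/-- Together with `sum_sum_smul_opIntegral_expRemainder`: on `Lam d (n - 1)` the stationary kernel,
with `2n = 2k + 2` Taylor terms, agrees with the positive semidefinite kernel built from remainders
with `n` terms, which is the one realized as a covariance. -/
theorem convEval_spectralKernel (hT : IsTPlusMeasure χ) (n : ℕ) {l m : FinMeas d}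
    (hl : l ∈ Lam d (n - 1)) (hm : m ∈ Lam d (n - 1)) :
    convEval (spectralKernel (n - 1) (Metric.ball 0 1) χ 0) l m = spectralCov χ n l m := by
  have hk : (2 * ((n : ℤ) - 1) + 2) = ((2 * n : ℕ) : ℤ) := by push_cast; ring
  have e : ∀ h, spectralKernel (n - 1) (Metric.ball 0 1) χ 0 h =
      opIntegral χ (expRemainder (2 * n) h) := by
    intro h
    unfold spectralKernel
    rw [hk]
    simp only [zpow_natCast, Int.toNat_natCast, Pi.zero_apply, add_zero]
    rfl
  unfold convEval spectralCov
  simp only [e]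
  rw [sum_sum_smul_opIntegral hT l m (g := fun t s => expRemainder (2 * n) (t - s))
    (fun t s => measurable_expRemainder _ _) fun t s => ⟨_, norm_expRemainder_le _ _⟩]
  simp only [sum_sum_expRemainder hl hm]

theorem sum_sum_smul_opIntegral_expRemainder (hT : IsTPlusMeasure χ) (n : ℕ) {l m : FinMeas d}
    (hl : l ∈ Lam d (n - 1)) (hm : m ∈ Lam d (n - 1)) :
    (l.sum fun t a => m.sum fun s b => (a * conj b) •
      opIntegral χ fun u => expRemainder n t u * conj (expRemainder n s u)) =
      spectralCov χ n l m := by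
  unfold spectralCov
  rw [sum_sum_smul_opIntegral hT l m
    (g := fun t s u => expRemainder n t u * conj (expRemainder n s u)) (fun t s =>
    (measurable_expRemainder n t).mul
      (Complex.continuous_conj.measurable.comp (measurable_expRemainder n s))) fun t s => by
    refine ⟨(‖t‖ ^ n * Real.exp ‖t‖ + 1) * (‖s‖ ^ n * Real.exp ‖s‖ + 1), fun u => ?_⟩
    rw [norm_mul, RCLike.norm_conj]
    exact mul_le_mul (norm_expRemainder_le n t u) (norm_expRemainder_le n s u) (norm_nonneg _)
      (by positivity)]
  congr 1
  funext u
  have e : (l.sum fun t a => m.sum fun s b =>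
      (a * conj b) * (expRemainder n t u * conj (expRemainder n s u))) =
      (l.sum fun t a => a * expRemainder n t u) *
        conj (m.sum fun s b => b * expRemainder n s u) := by
    unfold Finsupp.sum
    rw [map_sum, Finset.sum_mul_sum]
    refine Finset.sum_congr rfl fun t _ => Finset.sum_congr rfl fun s _ => ?_
    rw [map_mul]
    ring
  rw [e, sum_expRemainder hl, sum_expRemainder hm, map_div₀, div_mul_div_comm, Complex.conj_ofReal,
    ← Complex.ofReal_mul]
  congr 2
  -- The square of `1 ∧ ‖u‖ ^ n` is `1 ∧ ‖u‖ ^ (2n)`.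
  rcases le_total 1 ‖u‖ with h | h
  · rw [min_eq_left (one_le_pow₀ h), min_eq_left (one_le_pow₀ h), one_mul]
  · rw [min_eq_right (pow_le_one₀ (norm_nonneg _) h), min_eq_right (pow_le_one₀ (norm_nonneg _) h)]
    ring

/-- Translation multiplies both Fourier transforms by the same unimodular factor. -/
theorem spectralCov_translate (χ : VectorMeasure (EuclideanSpace ℝ (Fin d)) (V →L[ℂ] V)) (n : ℕ)
    {k : ℤ} (w : EuclideanSpace ℝ (Fin d)) (l m : Lam d k) :
    spectralCov χ n (translate w l).1 (translate w m).1 = spectralCov χ n l.1 m.1 := by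
  unfold spectralCov
  congr 1
  funext u
  rw [fourier_translate, fourier_translate, map_mul, mul_mul_mul_comm, Complex.mul_conj']
  rw [mul_comm Complex.I, Complex.norm_exp_ofReal_mul_I]
  simp

/-- Every finite measure with values in the positive trace-class operators is the spectral measure
of an intrinsic random function without polynomial component. -/
theorem exists_irf_of_isTPlusMeasure [TopologicalSpace.SeparableSpace V] [MeasurableSpace V]
    (hT : IsTPlusMeasure χ) (h0 : χ {0} = 0) (n : ℕ) :
    ∃ (Ω : Type w) (_ : MeasurableSpace Ω) (P : Measure Ω) (Y : Lam d (n - 1) →ₗ[ℂ] (Ω → V)),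
      IsProbabilityMeasure P ∧ IsIRF P Y ∧ IsMeanSquareContinuous P Y ∧
      HasSpectralCharacteristics P Y χ 0 ∧
      (∀ l m, Integrable (fun ω => InnerProductSpace.rankOne ℂ (Y l ω) (Y m ω)) P) ∧
      ∀ l m, crossCov P (Y l) (Y m) = spectralCov χ n l.1 m.1 := by
  obtain ⟨p, hp, hlim, hsum⟩ := exists_factorization hT (measurable_expRemainder n)
    (expRemainder_bounded n) (continuous_expRemainder n)
  let Y : Lam d (n - 1) →ₗ[ℂ] (SignSpace.{w} → V) :=
    { toFun := fun l ω => l.1.sum fun t c => c • signField p t ω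
      map_add' := fun l m => by
        funext ω
        exact Finsupp.sum_add_index' (by simp) (by intros; rw [add_smul])
      map_smul' := fun z l => by
        funext ω
        simp only [Submodule.coe_smul, Pi.smul_apply, RingHom.id_apply]
        rw [Finsupp.sum_smul_index' (by simp), Finsupp.smul_sum]
        simp only [smul_eq_mul, mul_smul] }
  have hX : ∀ t, MemLp (signField.{w} p t) 2 signMeasure := fun t => memLp_signField (hp t)
  have hY : ∀ l, MemLp (Y l) 2 signMeasure := fun l =>
    memLp_finsetSum l.1.support (f := fun t ω => l.1 t • signField p t ω)
      fun t _ => (hX t).const_smul (l.1 t)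
  have hcov : ∀ l m, crossCov signMeasure (Y l) (Y m) = spectralCov χ n l.1 m.1 := by
    intro l m
    rw [← sum_sum_smul_opIntegral_expRemainder hT n l.2 m.2]
    refine (crossCov_sum _ _ _ _ fun i j => integrable_rankOne (hX i) (hX j)).trans ?_
    refine Finset.sum_congr rfl fun t _ => Finset.sum_congr rfl fun s _ => ?_
    congr 1
    exact ext_quadratic fun x => inner_crossCov_signField hp t s x x (hsum t s x x)
  refine ⟨SignSpace.{w}, inferInstance, signMeasure, Y, inferInstance,
    ⟨fun l => .of_discrete, hY, fun l => ?_, fun w l m => ?_⟩,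
    ⟨signField p, hX, fun l ω => rfl, fun t => ?_⟩,
    ⟨hT, h0, ⟨0, by simp, fun h => by simp⟩, fun l _ => ?_, Metric.ball 0 1, measurableSet_ball,
      Metric.isBounded_ball, Metric.ball_mem_nhds _ one_pos, fun l m => ?_⟩,
    fun l m => integrable_rankOne (hY l) (hY m), hcov⟩
  · change ∫ ω, ∑ t ∈ l.1.support, l.1 t • signField p t ω ∂signMeasure = 0
    rw [integral_finsetSum _ fun t _ => ((hX t).integrable (by norm_num)).fun_smul (l.1 t)]
    refine Finset.sum_eq_zero fun t _ => ?_
    rw [integral_smul, integral_signField (hp t), smul_zero]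
  · rw [hcov, hcov, spectralCov_translate]
  · have h := ((ENNReal.continuous_rpow_const (y := 1 / 2)).tendsto 0).comp (hlim t)
    have e : ∀ s, (∑' n, ‖p n s - p n t‖ₑ ^ 2) ^ (1 / 2 : ℝ) =
        eLpNorm (signField.{w} p s - signField p t) 2 signMeasure := fun s => by
      rw [← eLpNorm_signField_sub_sq.{w}, ← ENNReal.rpow_natCast, ← ENNReal.rpow_mul]
      simp
    simp only [Function.comp_def, e] at h
    simpa using h
  · have : convEval (0 : EuclideanSpace ℝ (Fin d) → V →L[ℂ] V) l l = 0 := by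
      simp [convEval]
    rw [this]
    exact ContinuousLinearMap.isPositive_zero
  · rw [hcov, convEval_spectralKernel hT n l.2 m.2]

end Spectral

/-! ### Powers `c ^ H` and their action on eigenvectors. -/

section OpPow

variable {V : Type*} [NormedAddCommGroup V] [InnerProductSpace ℂ V] [CompleteSpace V]

theorem opPow_mul {r c : ℝ} (hr : 0 < r) (hc : 0 < c) (A : V →L[ℂ] V) :
    opPow (r * c) A = opPow r A * opPow c A := by
  let _ : NormedAlgebra ℚ (V →L[ℂ] V) := .restrictScalars ℚ ℂ _
  unfold opPow
  rw [Real.log_mul hr.ne' hc.ne', Complex.ofReal_add, add_smul]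
  exact NormedSpace.exp_add_of_commute (((Commute.refl A).smul_left _).smul_right _)

theorem opPow_neg_mul_opPow (c : ℝ) (A : V →L[ℂ] V) : opPow c (-A) * opPow c A = 1 := by
  let _ : NormedAlgebra ℚ (V →L[ℂ] V) := .restrictScalars ℚ ℂ _
  unfold opPow
  rw [← NormedSpace.exp_add_of_commute]
  · simp
  · exact ((Commute.refl A).neg_left.smul_left _).smul_right _

theorem adjoint_opPow (c : ℝ) (A : V →L[ℂ] V) :
    ContinuousLinearMap.adjoint (opPow c A) = opPow c (ContinuousLinearMap.adjoint A) := by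
  unfold opPow
  rw [← ContinuousLinearMap.star_eq_adjoint, NormedSpace.star_exp, star_smul,
    ContinuousLinearMap.star_eq_adjoint]
  simp

theorem stronglyMeasurable_opPow (A : V →L[ℂ] V) : StronglyMeasurable fun r => opPow r A := by
  let _ : NormedAlgebra ℚ (V →L[ℂ] V) := .restrictScalars ℚ ℂ _
  have : Continuous fun x : ℝ => NormedSpace.exp ((x : ℂ) • A) :=
    NormedSpace.exp_continuous.comp (by fun_prop)
  exact this.stronglyMeasurable.comp_measurable Real.measurable_log

theorem exp_apply_of_eigenvector {A : V →L[ℂ] V} {μ : ℂ} {v : V} (h : A v = μ • v) :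
    (NormedSpace.exp A) v = Complex.exp μ • v := by
  have hp : ∀ n : ℕ, (A ^ n) v = μ ^ n • v := by
    intro n
    induction n with
    | zero => simp
    | succ n ih => rw [pow_succ', mul_apply_eq_comp, ih, map_smul, h, smul_smul, pow_succ]
  have h1 := (ContinuousLinearMap.apply ℂ V v).hasSum
    (NormedSpace.exp_series_hasSum_exp' (𝕂 := ℂ) A)
  have h2 := (NormedSpace.exp_series_hasSum_exp' (𝕂 := ℂ) μ).smul_const v
  rw [← Complex.exp_eq_exp_ℂ] at h2
  refine h1.unique (h2.congr_fun fun n => ?_)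
  simp [hp, smul_smul]

/-- Testing the weak sum against `e j` leaves one term. The adjoint is what matters, since the
quadratic form of `r^{-H} A r^{-H*}` at `x` is that of `A` at `r^{-H*} x`. -/
theorem IsNormalDiagonal.adjoint_apply {ι : Type*} {H : V →L[ℂ] V} {e : HilbertBasis ι ℂ V}
    {lam : ι → ℂ} (h : IsNormalDiagonal H e lam) (j : ι) :
    ContinuousLinearMap.adjoint H (e j) = conj (lam j) • e j := by
  refine ext_inner_right ℂ fun y => ?_
  rw [ContinuousLinearMap.adjoint_inner_left, inner_smul_left, Complex.conj_conj]
  classical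
  refine (h.2 (e j) y).unique ((hasSum_ite_eq j (lam j * ⟪e j, y⟫_ℂ)).congr_fun fun i => ?_)
  rw [smul_apply, InnerProductSpace.rankOne_apply, inner_smul_right, inner_smul_right]
  split_ifs with h1
  · subst h1
    rw [inner_self_eq_norm_sq_to_K, e.orthonormal.norm_eq_one]
    simp
  · rw [e.orthonormal.inner_eq_zero (Ne.symm h1), mul_zero, mul_zero]

theorem IsNormalDiagonal.norm_sq_opPow_eigenvalue {ι : Type*} {H : V →L[ℂ] V}
    {e : HilbertBasis ι ℂ V} {lam : ι → ℂ} (h : IsNormalDiagonal H e lam) (A : V →L[ℂ] V)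
    {r : ℝ} (hr : 0 < r) (j : ι) :
    (⟪opPow r (-ContinuousLinearMap.adjoint H) (e j),
      A (opPow r (-ContinuousLinearMap.adjoint H) (e j))⟫_ℂ).re =
      r ^ (-2 * (lam j).re) * (⟪e j, A (e j)⟫_ℂ).re := by
  have h1 : opPow r (-ContinuousLinearMap.adjoint H) (e j) =
      Complex.exp (-(Real.log r) * conj (lam j)) • e j := by
    refine exp_apply_of_eigenvector ?_
    rw [smul_apply, neg_apply, h.adjoint_apply, ← neg_smul, smul_smul]
    simp
  rw [h1, map_smul, inner_smul_left, inner_smul_right, ← mul_assoc, Complex.conj_mul',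
    Complex.norm_exp, ← Complex.ofReal_pow, Complex.re_ofReal_mul]
  congr 1
  rw [← Real.exp_nat_mul, Real.rpow_def_of_pos hr]
  congr 1
  simp
  ring

end OpPow

/-! ### The radial integrals and the summability condition. -/

section Radial

theorem radialDensity_of_le_one {n : ℕ} {a r : ℝ} (hr : 0 < r) (hr1 : r ≤ 1) :
    min 1 (r ^ (2 * n)) * r⁻¹ * r ^ (-2 * a) = r ^ (2 * (n : ℝ) - 2 * a - 1) := by
  rw [min_eq_right (pow_le_one₀ hr.le hr1), ← Real.rpow_natCast, ← Real.rpow_neg_one,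
    ← Real.rpow_add hr, ← Real.rpow_add hr]
  congr 1
  push_cast
  ring

theorem radialDensity_of_one_le {n : ℕ} {a r : ℝ} (hr1 : 1 ≤ r) :
    min 1 (r ^ (2 * n)) * r⁻¹ * r ^ (-2 * a) = r ^ (-2 * a - 1) := by
  have hr : 0 < r := by linarith
  rw [min_eq_left (one_le_pow₀ hr1), one_mul, ← Real.rpow_neg_one, ← Real.rpow_add hr]
  congr 1
  ring

/-- `∫_0^∞ (1 ∧ r ^ (2n)) r ^ (-2a) dr / r`. -/
noncomputable def radialIntegral (n : ℕ) (a : ℝ) : ℝ≥0∞ :=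
  ∫⁻ r in Set.Ioi (0 : ℝ), ENNReal.ofReal (min 1 (r ^ (2 * n)) * r⁻¹ * r ^ (-2 * a))

theorem radialIntegral_eq_add (n : ℕ) (a : ℝ) :
    radialIntegral n a = (∫⁻ r in Set.Ioc (0 : ℝ) 1, ENNReal.ofReal (r ^ (2 * (n : ℝ) - 2 * a - 1)))
      + ∫⁻ r in Set.Ioi (1 : ℝ), ENNReal.ofReal (r ^ (-2 * a - 1)) := by
  unfold radialIntegral
  rw [← Set.Ioc_union_Ioi_eq_Ioi (zero_le_one' ℝ), lintegral_union measurableSet_Ioi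
    (Set.disjoint_left.2 fun x hx hx' => not_lt.2 hx.2 hx')]
  congr 1
  · exact setLIntegral_congr_fun measurableSet_Ioc fun r hr => by rw [radialDensity_of_le_one hr.1 hr.2]
  · exact setLIntegral_congr_fun measurableSet_Ioi fun r hr => by rw [radialDensity_of_one_le (le_of_lt hr)]

/-- Integrability of `r ^ (2n - 2a - 1)` at `0` forces `a < n`, that of `r ^ (-2a - 1)` at infinity
forces `0 < a`. -/
theorem pos_and_lt_of_radialIntegral_ne_top {n : ℕ} {a : ℝ} (h : radialIntegral n a ≠ ∞) :
    0 < a ∧ a < n := by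
  rw [radialIntegral_eq_add, ENNReal.add_ne_top] at h
  have key : ∀ (s : Set ℝ) (b : ℝ), MeasurableSet s → (∀ r ∈ s, 0 < r) →
      (∫⁻ r in s, ENNReal.ofReal (r ^ b)) ≠ ∞ → IntegrableOn (fun r => r ^ b) s := by
    intro s b hs hpos hfin
    refine ⟨(measurable_id.pow_const b).aestronglyMeasurable, ?_⟩
    rw [hasFiniteIntegral_iff_ofReal]
    · exact hfin.lt_top
    · exact (ae_restrict_iff' hs).2 (.of_forall fun r hr => Real.rpow_nonneg (hpos r hr).le b)
  have h1 := key _ _ measurableSet_Ioc (fun r hr => hr.1) h.1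
  have h2 := key _ _ measurableSet_Ioi (fun r hr => zero_lt_one.trans hr) h.2
  rw [integrableOn_Ioi_rpow_iff one_pos] at h2
  rw [integrableOn_Ioc_iff_integrableOn_Ioo, intervalIntegral.integrableOn_Ioo_rpow_iff one_pos]
    at h1
  constructor <;> linarith

theorem radialIntegral_eq {n : ℕ} {a : ℝ} (h0 : 0 < a) (hn : a < n) :
    radialIntegral n a = ENNReal.ofReal (2⁻¹ * (1 / (n - a) + 1 / a)) := by
  have hna : 0 < n - a := by linarith
  rw [radialIntegral_eq_add, ← ofReal_integral_eq_lintegral_ofReal,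
    ← ofReal_integral_eq_lintegral_ofReal, ← intervalIntegral.integral_of_le zero_le_one,
    integral_rpow (Or.inl (by linarith)), integral_Ioi_rpow_of_lt (by linarith) one_pos,
    ← ENNReal.ofReal_add]
  · congr 1
    rw [Real.zero_rpow (by linarith), Real.one_rpow, Real.one_rpow]
    have e1 : 2 * (n : ℝ) - 2 * a - 1 + 1 = 2 * (n - a) := by ring
    have e2 : -2 * a - 1 + 1 = -(2 * a) := by ring
    rw [e1, e2]
    field_simp
    ring
  · rw [Real.zero_rpow (by linarith), Real.one_rpow]
    exact div_nonneg (by norm_num) (by linarith)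
  · rw [Real.one_rpow]
    exact div_nonneg_of_nonpos (by norm_num) (by linarith)
  · exact integrableOn_Ioi_rpow_of_lt (by linarith) one_pos
  · exact (ae_restrict_iff' measurableSet_Ioi).2 (.of_forall fun r hr =>
      Real.rpow_nonneg (zero_lt_one.trans hr).le _)
  · exact (intervalIntegrable_iff_integrableOn_Ioc_of_le zero_le_one).1
      (intervalIntegral.intervalIntegrable_rpow' (by linarith))
  · exact (ae_restrict_iff' measurableSet_Ioc).2 (.of_forall fun r hr =>
      Real.rpow_nonneg hr.1.le _)

theorem tsum_radialIntegral_ne_top_iff {ι : Type*} (n : ℕ) {a s : ι → ℝ} (hs : ∀ j, 0 ≤ s j) :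
    (∑' j, ENNReal.ofReal (s j) * radialIntegral n (a j)) ≠ ∞ ↔
      (∀ j, 0 < s j → 0 < a j ∧ a j < n) ∧
        Summable fun j => (1 / (n - a j) + 1 / a j) * s j := by
  have key : (∀ j, 0 < s j → 0 < a j ∧ a j < n) → ∀ j, ENNReal.ofReal (s j) *
      radialIntegral n (a j) = ENNReal.ofReal (2⁻¹ * ((1 / (n - a j) + 1 / a j) * s j)) ∧
      0 ≤ 2⁻¹ * ((1 / (n - a j) + 1 / a j) * s j) := by
    intro h j
    rcases (hs j).eq_or_lt with h0 | h0
    -- If `s j = 0` both sides vanish, even when the radial integral is infinite, since `0 * ∞ = 0`: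
    -- this is the convention for vanishing terms.
    · simp [← h0]
    · obtain ⟨h1, h2⟩ := h j h0
      have h3 : 0 < n - a j := by linarith
      rw [radialIntegral_eq h1 h2, ← ENNReal.ofReal_mul h0.le]
      exact ⟨by congr 1; ring, by positivity⟩
  constructor
  · intro h
    have h1 : ∀ j, 0 < s j → 0 < a j ∧ a j < n := fun j hj => by
      have h2 := ENNReal.ne_top_of_tsum_ne_top h j
      refine pos_and_lt_of_radialIntegral_ne_top fun h3 => h2 ?_
      rw [h3, ENNReal.mul_top (by simpa using hj)]
    refine ⟨h1, ?_⟩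
    simp only [fun j => (key h1 j).1] at h
    have h2 := ENNReal.summable_toReal h
    simp only [fun j => ENNReal.toReal_ofReal (key h1 j).2] at h2
    exact (summable_mul_left_iff (by norm_num)).1 h2
  · rintro ⟨h1, h2⟩
    simp only [fun j => (key h1 j).1]
    rw [← ENNReal.ofReal_tsum_of_nonneg (fun j => (key h1 j).2) (h2.mul_left _)]
    exact ENNReal.ofReal_ne_top

/-- Scale invariance of `dr / r`. -/
theorem lintegral_Ioi_inv_mul_comp_mul {c : ℝ} (hc : 0 < c) (F : ℝ → ℝ≥0∞) (hF : Measurable F) :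
    ∫⁻ r in Set.Ioi (0 : ℝ), ENNReal.ofReal r⁻¹ * F (c * r) =
      ∫⁻ r in Set.Ioi (0 : ℝ), ENNReal.ofReal r⁻¹ * F r := by
  have h1 : ∀ r ∈ Set.Ioi (0 : ℝ), ENNReal.ofReal r⁻¹ * F (c * r) =
      ENNReal.ofReal c * (ENNReal.ofReal (c * r)⁻¹ * F (c * r)) := by
    intro r hr
    rw [← mul_assoc, ← ENNReal.ofReal_mul hc.le, mul_inv, mul_inv_cancel_left₀ hc.ne']
  rw [setLIntegral_congr_fun measurableSet_Ioi h1]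
  have hG : Measurable fun r => ENNReal.ofReal r⁻¹ * F r :=
    (measurable_inv.ennreal_ofReal).mul hF
  have hG2 : Measurable fun r => ENNReal.ofReal (c * r)⁻¹ * F (c * r) :=
    hG.comp (measurable_const_mul c)
  rw [lintegral_const_mul _ hG2, ← lintegral_indicator measurableSet_Ioi,
    ← lintegral_indicator measurableSet_Ioi]
  have h2 : (fun r => (Set.Ioi (0 : ℝ)).indicator
      (fun r => ENNReal.ofReal (c * r)⁻¹ * F (c * r)) r) =
      fun r => (Set.Ioi (0 : ℝ)).indicator (fun r => ENNReal.ofReal r⁻¹ * F r) (c * r) := by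
    funext r
    have : (0 < c * r) ↔ 0 < r := mul_pos_iff_of_pos_left hc
    by_cases hr : 0 < r
    · rw [Set.indicator_of_mem (by exact hr), Set.indicator_of_mem (by exact this.2 hr)]
    · rw [Set.indicator_of_notMem (by exact hr), Set.indicator_of_notMem (by exact mt this.1 hr)]
  rw [h2, ← lintegral_map (f := (Set.Ioi (0 : ℝ)).indicator (fun r => ENNReal.ofReal r⁻¹ * F r))
    (hG.indicator measurableSet_Ioi) (measurable_const_mul c), Real.map_volume_mul_left hc.ne',
    lintegral_smul_measure, smul_eq_mul, ← mul_assoc, abs_of_pos (inv_pos.2 hc),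
    ← ENNReal.ofReal_mul hc.le, mul_inv_cancel₀ hc.ne', ENNReal.ofReal_one, one_mul]

end Radial

/-! ### Measurability of spherical slices. -/

section Slice

variable {V : Type*} [NormedAddCommGroup V] [InnerProductSpace ℂ V] {d : ℕ}
  {σ : VectorMeasure (Metric.sphere (0 : EuclideanSpace ℝ (Fin d)) 1) (V →L[ℂ] V)}

theorem measurableSet_slice {D : Set (EuclideanSpace ℝ (Fin d))} (hD : MeasurableSet D) (r : ℝ) :
    MeasurableSet {θ : Metric.sphere (0 : EuclideanSpace ℝ (Fin d)) 1 |
      r • (θ : EuclideanSpace ℝ (Fin d)) ∈ D} :=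
  (measurable_subtype_coe.const_smul r) hD

/-- The space of operators need not be separable, so strong measurability is not automatic; it comes
from viewing these sets as sections of a measurable subset of `ℝ × 𝕊`. -/
theorem stronglyMeasurable_slice {D : Set (EuclideanSpace ℝ (Fin d))} (hD : MeasurableSet D) :
    StronglyMeasurable fun r : ℝ => σ {θ | r • (θ : EuclideanSpace ℝ (Fin d)) ∈ D} := by
  have : Measurable fun p : ℝ × Metric.sphere (0 : EuclideanSpace ℝ (Fin d)) 1 =>
      p.1 • (p.2 : EuclideanSpace ℝ (Fin d)) :=
    measurable_fst.smul (measurable_subtype_coe.comp measurable_snd)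
  exact VectorMeasure.stronglyMeasurable_vectorMeasure_prodMk_left (this hD)

end Slice

/-! ### The polar integrand, its trace and its Bochner integral. -/

section Polar

variable {V : Type*} [NormedAddCommGroup V] [InnerProductSpace ℂ V] [CompleteSpace V] {d : ℕ}
  {σ : VectorMeasure (Metric.sphere (0 : EuclideanSpace ℝ (Fin d)) 1) (V →L[ℂ] V)}
  {H : V →L[ℂ] V} {n : ℕ}

/-- The integrand `(1 ∧ r ^ (2n)) r^{-H} σ{θ : rθ ∈ D} r^{-H*} r⁻¹` of the polar form. -/
noncomputable def polarIntegrand (n : ℕ) (H : V →L[ℂ] V)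
    (σ : VectorMeasure (Metric.sphere (0 : EuclideanSpace ℝ (Fin d)) 1) (V →L[ℂ] V))
    (D : Set (EuclideanSpace ℝ (Fin d))) (r : ℝ) : V →L[ℂ] V :=
  (min 1 (r ^ (2 * n)) * r⁻¹ : ℝ) •
    (opPow r (-H) * σ {θ | r • (θ : EuclideanSpace ℝ (Fin d)) ∈ D} *
      opPow r (-ContinuousLinearMap.adjoint H))

theorem hasPolarForm_iff {χ : VectorMeasure (EuclideanSpace ℝ (Fin d)) (V →L[ℂ] V)} :
    HasPolarForm (n - 1) H σ χ ↔ ∀ D : Set (EuclideanSpace ℝ (Fin d)), MeasurableSet D →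
      (∃ ε : ℝ, 0 < ε ∧ ∀ x ∈ D, ε ≤ ‖x‖) →
      HasTraceIntegral (volume.restrict (Set.Ioi (0 : ℝ))) (polarIntegrand n H σ D) (χ D) := by
  have hk : (2 * ((n : ℤ) - 1) + 2) = ((2 * n : ℕ) : ℤ) := by push_cast; ring
  unfold HasPolarForm
  simp only [hk, zpow_natCast]
  rfl

theorem stronglyMeasurable_polarIntegrand {D : Set (EuclideanSpace ℝ (Fin d))}
    (hD : MeasurableSet D) : StronglyMeasurable (polarIntegrand n H σ D) := by
  have h1 : Measurable fun r : ℝ => min 1 (r ^ (2 * n)) * r⁻¹ := by fun_prop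
  exact h1.stronglyMeasurable.smul (((stronglyMeasurable_opPow _).mul
    (stronglyMeasurable_slice hD)).mul (stronglyMeasurable_opPow _))

theorem inner_polarIntegrand (D : Set (EuclideanSpace ℝ (Fin d))) (r : ℝ) (x : V) :
    ⟪x, polarIntegrand n H σ D r x⟫_ℂ = ((min 1 (r ^ (2 * n)) * r⁻¹ : ℝ) : ℂ) *
      ⟪opPow r (-ContinuousLinearMap.adjoint H) x,
        σ {θ | r • (θ : EuclideanSpace ℝ (Fin d)) ∈ D}
          (opPow r (-ContinuousLinearMap.adjoint H) x)⟫_ℂ := by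
  have h := adjoint_opPow r (-H)
  rw [map_neg] at h
  unfold polarIntegrand
  rw [smul_apply, RCLike.real_smul_eq_coe_smul (K := ℂ), inner_smul_right, mul_apply_eq_comp,
    mul_apply_eq_comp, ← ContinuousLinearMap.adjoint_inner_left, h]
  rfl

theorem isPositive_polarIntegrand (hσ : ∀ s, MeasurableSet s → (σ s).IsPositive)
    {D : Set (EuclideanSpace ℝ (Fin d))} (hD : MeasurableSet D) {r : ℝ} (hr : 0 < r) :
    (polarIntegrand n H σ D r).IsPositive := by
  have h := adjoint_opPow r (-H)
  rw [map_neg] at h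
  have h1 := (hσ _ (measurableSet_slice hD r)).conj_adjoint (opPow r (-H))
  have h2 : (0 : ℂ) ≤ ((min 1 (r ^ (2 * n)) * r⁻¹ : ℝ) : ℂ) := by
    exact_mod_cast (by positivity : (0 : ℝ) ≤ min 1 (r ^ (2 * n)) * r⁻¹)
  have h3 := h1.smul_of_nonneg h2
  rw [h] at h3
  exact h3

theorem ofReal_re_inner_polarIntegrand (hσ : ∀ s, MeasurableSet s → (σ s).IsPositive)
    {D : Set (EuclideanSpace ℝ (Fin d))} (hD : MeasurableSet D) {r : ℝ} (hr : 0 < r) (x : V) :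
    ENNReal.ofReal (⟪x, polarIntegrand n H σ D r x⟫_ℂ).re =
      ENNReal.ofReal (min 1 (r ^ (2 * n)) * r⁻¹) *
        quadMeasure hσ (opPow r (-ContinuousLinearMap.adjoint H) x)
          {θ | r • (θ : EuclideanSpace ℝ (Fin d)) ∈ D} := by
  rw [inner_polarIntegrand, Complex.re_ofReal_mul, ENNReal.ofReal_mul (by positivity),
    quadMeasure_apply hσ _ (measurableSet_slice hD r)]

theorem traceNorm_polarIntegrand (hσ : ∀ s, MeasurableSet s → (σ s).IsPositive)
    {ι : Type*} (e : HilbertBasis ι ℂ V)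
    {D : Set (EuclideanSpace ℝ (Fin d))} (hD : MeasurableSet D) {r : ℝ} (hr : 0 < r) :
    traceNorm (polarIntegrand n H σ D r) = ENNReal.ofReal (min 1 (r ^ (2 * n)) * r⁻¹) *
      ∑' j, quadMeasure hσ (opPow r (-ContinuousLinearMap.adjoint H) (e j))
          {θ | r • (θ : EuclideanSpace ℝ (Fin d)) ∈ D} := by
  rw [traceNorm_of_isPositive e (isPositive_polarIntegrand hσ hD hr), ← ENNReal.tsum_mul_left]
  exact tsum_congr fun j => ofReal_re_inner_polarIntegrand hσ hD hr (e j)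

theorem traceNorm_polarIntegrand_mono (hσ : ∀ s, MeasurableSet s → (σ s).IsPositive)
    {D : Set (EuclideanSpace ℝ (Fin d))} (hD : MeasurableSet D) {r : ℝ} (hr : 0 < r) :
    traceNorm (polarIntegrand n H σ D r) ≤ traceNorm (polarIntegrand n H σ Set.univ r) := by
  obtain ⟨w, e, -⟩ := exists_hilbertBasis ℂ V
  rw [traceNorm_polarIntegrand hσ e hD hr, traceNorm_polarIntegrand hσ e .univ hr]
  gcongr
  exact Set.subset_univ _

/-- In the eigenbasis of `H` the trace splits into products of a factor depending on `σ` and a power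
of `r`. -/
theorem traceNorm_polarIntegrand_univ (hσ : ∀ s, MeasurableSet s → (σ s).IsPositive)
    {ι : Type*} {e : HilbertBasis ι ℂ V} {lam : ι → ℂ} (hH : IsNormalDiagonal H e lam)
    {r : ℝ} (hr : 0 < r) :
    traceNorm (polarIntegrand n H σ Set.univ r) =
      ∑' j, ENNReal.ofReal (⟪e j, σ Set.univ (e j)⟫_ℂ).re *
        ENNReal.ofReal (min 1 (r ^ (2 * n)) * r⁻¹ * r ^ (-2 * (lam j).re)) := by
  rw [traceNorm_of_isPositive e (isPositive_polarIntegrand hσ .univ hr)]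
  refine tsum_congr fun j => ?_
  rw [inner_polarIntegrand, Complex.re_ofReal_mul, hH.norm_sq_opPow_eigenvalue _ hr,
    ← ENNReal.ofReal_mul (re_inner_nonneg_of_isPositive (hσ _ .univ) _)]
  simp only [Set.mem_univ, Set.ofPred_true]
  congr 1
  ring

/-- Positivity of the integrand, hence the formula for its trace as a countable sum of measurable
functions, is available for `r > 0`. -/
theorem aemeasurable_traceNorm_polarIntegrand [TopologicalSpace.SeparableSpace V]
    (hσ : ∀ s, MeasurableSet s → (σ s).IsPositive)
    {D : Set (EuclideanSpace ℝ (Fin d))} (hD : MeasurableSet D) :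
    AEMeasurable (fun r => traceNorm (polarIntegrand n H σ D r))
      (volume.restrict (Set.Ioi (0 : ℝ))) := by
  obtain ⟨w, e, -⟩ := exists_hilbertBasis ℂ V
  have := countable_of_hilbertBasis e
  refine ⟨fun r => ∑' j, ENNReal.ofReal (⟪e j, polarIntegrand n H σ D r (e j)⟫_ℂ).re,
    Measurable.tsum fun j => ?_, (ae_restrict_iff' measurableSet_Ioi).2 (.of_forall
      fun r hr => traceNorm_of_isPositive e (isPositive_polarIntegrand hσ hD hr))⟩
  have hc : Continuous fun A : V →L[ℂ] V => (⟪e j, A (e j)⟫_ℂ).re := by fun_prop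
  exact (hc.comp_stronglyMeasurable (stronglyMeasurable_polarIntegrand hD)).measurable.ennreal_ofReal

theorem lintegral_traceNorm_polarIntegrand_univ [TopologicalSpace.SeparableSpace V]
    (hσ : ∀ s, MeasurableSet s → (σ s).IsPositive)
    {ι : Type*} {e : HilbertBasis ι ℂ V} {lam : ι → ℂ} (hH : IsNormalDiagonal H e lam) :
    ∫⁻ r in Set.Ioi (0 : ℝ), traceNorm (polarIntegrand n H σ Set.univ r) =
      ∑' j, ENNReal.ofReal (⟪e j, σ Set.univ (e j)⟫_ℂ).re * radialIntegral n (lam j).re := by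
  have := countable_of_hilbertBasis e
  have hm : ∀ a : ℝ, Measurable fun r : ℝ =>
      ENNReal.ofReal (min 1 (r ^ (2 * n)) * r⁻¹ * r ^ (-2 * a)) := by
    intro a
    fun_prop
  rw [setLIntegral_congr_fun measurableSet_Ioi fun r hr =>
    traceNorm_polarIntegrand_univ hσ hH hr, lintegral_tsum fun j => ((hm _).const_mul _).aemeasurable]
  refine tsum_congr fun j => ?_
  rw [lintegral_const_mul _ (hm _), radialIntegral]

theorem integrable_of_lintegral_traceNorm (hσ : ∀ s, MeasurableSet s → (σ s).IsPositive)
    {D : Set (EuclideanSpace ℝ (Fin d))} (hD : MeasurableSet D)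
    (h : ∫⁻ r in Set.Ioi (0 : ℝ), traceNorm (polarIntegrand n H σ D r) < ∞) :
    IntegrableOn (polarIntegrand n H σ D) (Set.Ioi 0) :=
  ⟨(stronglyMeasurable_polarIntegrand hD).aestronglyMeasurable,
    (setLIntegral_mono_ae' measurableSet_Ioi (.of_forall fun _ hr =>
      enorm_le_traceNorm (isPositive_polarIntegrand hσ hD hr))).trans_lt h⟩

theorem inner_integral_polarIntegrand {D : Set (EuclideanSpace ℝ (Fin d))}
    (h : IntegrableOn (polarIntegrand n H σ D) (Set.Ioi 0)) (x : V) :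
    ⟪x, (∫ r in Set.Ioi (0 : ℝ), polarIntegrand n H σ D r) x⟫_ℂ =
      ∫ r in Set.Ioi (0 : ℝ), ⟪x, polarIntegrand n H σ D r x⟫_ℂ :=
  ((innerSL ℂ x ∘L ContinuousLinearMap.apply ℂ V x).integral_comp_comm h).symm

theorem re_inner_integral_polarIntegrand {D : Set (EuclideanSpace ℝ (Fin d))}
    (h : IntegrableOn (polarIntegrand n H σ D) (Set.Ioi 0)) (x : V) :
    (⟪x, (∫ r in Set.Ioi (0 : ℝ), polarIntegrand n H σ D r) x⟫_ℂ).re =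
      ∫ r in Set.Ioi (0 : ℝ), (⟪x, polarIntegrand n H σ D r x⟫_ℂ).re := by
  rw [inner_integral_polarIntegrand h]
  exact (integral_re ((innerSL ℂ x ∘L ContinuousLinearMap.apply ℂ V x).integrable_comp h)).symm

theorem isPositive_integral_polarIntegrand (hσ : ∀ s, MeasurableSet s → (σ s).IsPositive)
    {D : Set (EuclideanSpace ℝ (Fin d))} (hD : MeasurableSet D)
    (h : IntegrableOn (polarIntegrand n H σ D) (Set.Ioi 0)) :
    (∫ r in Set.Ioi (0 : ℝ), polarIntegrand n H σ D r).IsPositive := by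
  rw [ContinuousLinearMap.isPositive_iff_complex]
  intro x
  have h1 : ⟪x, (∫ r in Set.Ioi (0 : ℝ), polarIntegrand n H σ D r) x⟫_ℂ =
      ((∫ r in Set.Ioi (0 : ℝ), (⟪x, polarIntegrand n H σ D r x⟫_ℂ).re : ℝ) : ℂ) := by
    rw [inner_integral_polarIntegrand h, ← integral_complex_ofReal]
    exact setIntegral_congr_fun measurableSet_Ioi fun r hr =>
      inner_eq_re_of_isPositive (isPositive_polarIntegrand hσ hD hr) x
  have h2 : 0 ≤ ∫ r in Set.Ioi (0 : ℝ), (⟪x, polarIntegrand n H σ D r x⟫_ℂ).re :=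
    setIntegral_nonneg measurableSet_Ioi fun r hr =>
      re_inner_nonneg_of_isPositive (isPositive_polarIntegrand hσ hD hr) x
  rw [← inner_conj_symm, h1, Complex.conj_ofReal]
  exact ⟨by simp, by simpa using h2⟩

theorem ofReal_re_inner_integral_polarIntegrand (hσ : ∀ s, MeasurableSet s → (σ s).IsPositive)
    {D : Set (EuclideanSpace ℝ (Fin d))} (hD : MeasurableSet D)
    (h : IntegrableOn (polarIntegrand n H σ D) (Set.Ioi 0)) (x : V) :
    ENNReal.ofReal (⟪x, (∫ r in Set.Ioi (0 : ℝ), polarIntegrand n H σ D r) x⟫_ℂ).re =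
      ∫⁻ r in Set.Ioi (0 : ℝ), ENNReal.ofReal (⟪x, polarIntegrand n H σ D r x⟫_ℂ).re := by
  rw [re_inner_integral_polarIntegrand h]
  refine ofReal_integral_eq_lintegral_ofReal ?_ ?_
  · exact ((innerSL ℂ x ∘L ContinuousLinearMap.apply ℂ V x).integrable_comp h).re
  · exact (ae_restrict_iff' measurableSet_Ioi).2 (.of_forall fun r hr =>
      re_inner_nonneg_of_isPositive (isPositive_polarIntegrand hσ hD hr) x)

/-- Tonelli on the diagonal entries. It gives the trace-class property of `polarMeasure`, and
conversely recovers the integral of traces from `χ D` in the necessity part. -/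
theorem traceNorm_integral_polarIntegrand [TopologicalSpace.SeparableSpace V]
    (hσ : ∀ s, MeasurableSet s → (σ s).IsPositive)
    {D : Set (EuclideanSpace ℝ (Fin d))} (hD : MeasurableSet D)
    (h : IntegrableOn (polarIntegrand n H σ D) (Set.Ioi 0)) :
    traceNorm (∫ r in Set.Ioi (0 : ℝ), polarIntegrand n H σ D r) =
      ∫⁻ r in Set.Ioi (0 : ℝ), traceNorm (polarIntegrand n H σ D r) := by
  obtain ⟨w, e, -⟩ := exists_hilbertBasis ℂ V
  have := countable_of_hilbertBasis e
  rw [traceNorm_of_isPositive e (isPositive_integral_polarIntegrand hσ hD h),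
    setLIntegral_congr_fun measurableSet_Ioi fun r hr =>
      traceNorm_of_isPositive e (isPositive_polarIntegrand hσ hD hr), lintegral_tsum fun j => ?_]
  · exact tsum_congr fun j => ofReal_re_inner_integral_polarIntegrand hσ hD h (e j)
  · have hc : Continuous fun A : V →L[ℂ] V => (⟪e j, A (e j)⟫_ℂ).re := by fun_prop
    exact (hc.comp_stronglyMeasurable
      (stronglyMeasurable_polarIntegrand hD)).measurable.ennreal_ofReal.aemeasurable

end Polar

/-! ### The operator-valued measure defined by the polar form. -/

section PolarMeasure

variable {V : Type*} [NormedAddCommGroup V] [InnerProductSpace ℂ V] [CompleteSpace V] {d : ℕ}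
  {σ : VectorMeasure (Metric.sphere (0 : EuclideanSpace ℝ (Fin d)) 1) (V →L[ℂ] V)}
  {H : V →L[ℂ] V} {n : ℕ}

theorem hasSum_polarIntegrand {f : ℕ → Set (EuclideanSpace ℝ (Fin d))}
    (hf : ∀ i, MeasurableSet (f i)) (hd : Pairwise (Function.onFun Disjoint f)) (r : ℝ) :
    HasSum (fun i => polarIntegrand n H σ (f i) r) (polarIntegrand n H σ (⋃ i, f i) r) := by
  have h := σ.m_iUnion (fun i => measurableSet_slice (hf i) r) fun i j hij =>
    Set.disjoint_left.2 fun θ h1 h2 => Set.disjoint_left.1 (hd hij) h1 h2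
  have h2 : (⋃ i, {θ : Metric.sphere (0 : EuclideanSpace ℝ (Fin d)) 1 |
      r • (θ : EuclideanSpace ℝ (Fin d)) ∈ f i}) =
      {θ : Metric.sphere (0 : EuclideanSpace ℝ (Fin d)) 1 |
        r • (θ : EuclideanSpace ℝ (Fin d)) ∈ ⋃ i, f i} := by
    ext θ
    simp
  rw [h2] at h
  exact ((h.mul_left (opPow r (-H))).mul_right (opPow r (-ContinuousLinearMap.adjoint H))).const_smul
    (min 1 (r ^ (2 * n)) * r⁻¹ : ℝ)

theorem tsum_traceNorm_polarIntegrand (hσ : ∀ s, MeasurableSet s → (σ s).IsPositive)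
    {f : ℕ → Set (EuclideanSpace ℝ (Fin d))}
    (hf : ∀ i, MeasurableSet (f i)) (hd : Pairwise (Function.onFun Disjoint f)) {r : ℝ}
    (hr : 0 < r) : ∑' i, traceNorm (polarIntegrand n H σ (f i) r) =
      traceNorm (polarIntegrand n H σ (⋃ i, f i) r) := by
  obtain ⟨w, e, -⟩ := exists_hilbertBasis ℂ V
  rw [traceNorm_of_isPositive e (isPositive_polarIntegrand hσ (.iUnion hf) hr)]
  simp only [fun i => traceNorm_of_isPositive e
    (isPositive_polarIntegrand (n := n) (H := H) hσ (hf i) hr)]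
  rw [ENNReal.tsum_comm]
  refine tsum_congr fun j => ?_
  have h := Complex.hasSum_re (hasSum_inner_apply
    (hasSum_polarIntegrand (n := n) (H := H) (σ := σ) hf hd r) (e j) (e j))
  rw [← h.tsum_eq, ENNReal.ofReal_tsum_of_nonneg (fun i => re_inner_nonneg_of_isPositive
    (isPositive_polarIntegrand hσ (hf i) hr) _) h.summable]

open Classical in
/-- The measure `χ(dr dθ) = (1 ∧ r ^ (2n)) r^{-H} σ(dθ) r^{-H*} dr / r` on `ℝᵈ`. -/
noncomputable def polarMeasure [TopologicalSpace.SeparableSpace V] (n : ℕ) (H : V →L[ℂ] V)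
    (hσ : ∀ s, MeasurableSet s → (σ s).IsPositive)
    (hfin : ∫⁻ r in Set.Ioi (0 : ℝ), traceNorm (polarIntegrand n H σ Set.univ r) < ∞) :
    VectorMeasure (EuclideanSpace ℝ (Fin d)) (V →L[ℂ] V) where
  measureOf' D := if MeasurableSet D then ∫ r in Set.Ioi (0 : ℝ), polarIntegrand n H σ D r else 0
  empty' := by
    rw [if_pos .empty]
    simp [polarIntegrand]
  not_measurable' D hD := if_neg hD
  m_iUnion' f hf hd := by
    have hU := MeasurableSet.iUnion hf
    simp only [if_pos hU, if_pos (hf _)]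
    have hlt : ∀ {D : Set (EuclideanSpace ℝ (Fin d))}, MeasurableSet D →
        ∫⁻ r in Set.Ioi (0 : ℝ), traceNorm (polarIntegrand n H σ D r) < ∞ := fun hD =>
      (setLIntegral_mono_ae' measurableSet_Ioi (.of_forall fun _ hr =>
        traceNorm_polarIntegrand_mono hσ hD hr)).trans_lt hfin
    have hpos : ∀ᵐ r ∂volume.restrict (Set.Ioi (0 : ℝ)), 0 < r :=
      ae_restrict_mem measurableSet_Ioi
    have hae : ∀ {D : Set (EuclideanSpace ℝ (Fin d))}, MeasurableSet D →
        ∀ᵐ r ∂volume.restrict (Set.Ioi (0 : ℝ)), traceNorm (polarIntegrand n H σ D r) < ∞ :=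
      fun hD => ae_lt_top' (aemeasurable_traceNorm_polarIntegrand hσ hD) (hlt hD).ne
    -- Domination uses trace norms: unlike operator norms they add up over disjoint sets, so the
    -- dominating series sums to the integrable trace norm over the union.
    refine hasSum_integral_of_dominated_convergence
      (fun i r => (traceNorm (polarIntegrand n H σ (f i) r)).toReal)
      (fun i => (stronglyMeasurable_polarIntegrand (hf i)).aestronglyMeasurable) (fun i => ?_) ?_ ?_
      (.of_forall fun r => hasSum_polarIntegrand hf hd r)
    · filter_upwards [hpos, hae (hf i)] with r hr h1
      have := ENNReal.toReal_mono h1.ne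
        (enorm_le_traceNorm (isPositive_polarIntegrand (n := n) (H := H) hσ (hf i) hr))
      rwa [toReal_enorm] at this
    · filter_upwards [hpos, hae hU] with r hr h1
      refine ENNReal.summable_toReal ?_
      rw [tsum_traceNorm_polarIntegrand hσ hf hd hr]
      exact h1.ne
    · refine (integrable_toReal_of_lintegral_ne_top
        (aemeasurable_traceNorm_polarIntegrand hσ hU) (hlt hU).ne).congr ?_
      filter_upwards [hpos, ae_all_iff.2 fun i => hae (hf i)] with r hr h1
      rw [← tsum_traceNorm_polarIntegrand hσ hf hd hr, ENNReal.tsum_toReal_eq fun i => (h1 i).ne]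

theorem lintegral_traceNorm_polarIntegrand_lt_top
    (hσ : ∀ s, MeasurableSet s → (σ s).IsPositive)
    (hfin : ∫⁻ r in Set.Ioi (0 : ℝ), traceNorm (polarIntegrand n H σ Set.univ r) < ∞) {D : Set (EuclideanSpace ℝ (Fin d))}
    (hD : MeasurableSet D) :
    ∫⁻ r in Set.Ioi (0 : ℝ), traceNorm (polarIntegrand n H σ D r) < ∞ :=
  (setLIntegral_mono_ae' measurableSet_Ioi (.of_forall fun _ hr =>
    traceNorm_polarIntegrand_mono hσ hD hr)).trans_lt hfin

variable [TopologicalSpace.SeparableSpace V] (hσ : ∀ s, MeasurableSet s → (σ s).IsPositive)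
  (hfin : ∫⁻ r in Set.Ioi (0 : ℝ), traceNorm (polarIntegrand n H σ Set.univ r) < ∞)

theorem polarMeasure_apply {D : Set (EuclideanSpace ℝ (Fin d))} (hD : MeasurableSet D) :
    polarMeasure n H hσ hfin D = ∫ r in Set.Ioi (0 : ℝ), polarIntegrand n H σ D r :=
  if_pos hD

theorem isTPlusMeasure_polarMeasure : IsTPlusMeasure (polarMeasure n H hσ hfin) := by
  intro D hD
  have h1 := lintegral_traceNorm_polarIntegrand_lt_top hσ hfin hD
  have h2 := integrable_of_lintegral_traceNorm hσ hD h1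
  rw [polarMeasure_apply hσ hfin hD]
  refine ⟨isPositive_integral_polarIntegrand hσ hD h2, ?_⟩
  unfold IsTraceClass
  rwa [traceNorm_integral_polarIntegrand hσ hD h2]

theorem hasPolarForm_polarMeasure : HasPolarForm (n - 1) H σ (polarMeasure n H hσ hfin) :=
  hasPolarForm_iff.2 fun _ hD _ =>
    ⟨(stronglyMeasurable_polarIntegrand hD).aestronglyMeasurable,
      lintegral_traceNorm_polarIntegrand_lt_top hσ hfin hD, polarMeasure_apply hσ hfin hD⟩

theorem polarMeasure_singleton_zero : polarMeasure n H hσ hfin {0} = 0 := by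
  rw [polarMeasure_apply hσ hfin (measurableSet_singleton 0)]
  refine setIntegral_eq_zero_of_forall_eq_zero fun r hr => ?_
  have : {θ : Metric.sphere (0 : EuclideanSpace ℝ (Fin d)) 1 |
      r • (θ : EuclideanSpace ℝ (Fin d)) ∈ ({0} : Set (EuclideanSpace ℝ (Fin d)))} = ∅ := by
    ext θ
    simpa [(Set.mem_Ioi.1 hr).ne'] using ne_zero_of_mem_unit_sphere θ
  rw [polarIntegrand, this]
  simp

end PolarMeasure

/-! ### Homogeneity of the unweighted measure and self-similarity. -/

section Homogeneous

variable {V : Type*} [NormedAddCommGroup V] [InnerProductSpace ℂ V] [CompleteSpace V] {d : ℕ}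
  {σ : VectorMeasure (Metric.sphere (0 : EuclideanSpace ℝ (Fin d)) 1) (V →L[ℂ] V)}
  (hσ : ∀ s, MeasurableSet s → (σ s).IsPositive) (H : V →L[ℂ] V)

/-- The image on the sphere of radius `r` of the scalar measure `⟨r^{-H} σ(·) r^{-H*} x, x⟩`. -/
noncomputable def fiberMeasure (x : V) (r : ℝ) : Measure (EuclideanSpace ℝ (Fin d)) :=
  (quadMeasure hσ (opPow r (-ContinuousLinearMap.adjoint H) x)).map
    fun θ : Metric.sphere (0 : EuclideanSpace ℝ (Fin d)) 1 => r • (θ : EuclideanSpace ℝ (Fin d))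

theorem measurable_smul_coe_sphere (r : ℝ) :
    Measurable fun θ : Metric.sphere (0 : EuclideanSpace ℝ (Fin d)) 1 =>
      r • (θ : EuclideanSpace ℝ (Fin d)) :=
  measurable_subtype_coe.const_smul r

theorem fiberMeasure_apply (x : V) (r : ℝ) {D : Set (EuclideanSpace ℝ (Fin d))}
    (hD : MeasurableSet D) : fiberMeasure hσ H x r D =
      quadMeasure hσ (opPow r (-ContinuousLinearMap.adjoint H) x)
        {θ | r • (θ : EuclideanSpace ℝ (Fin d)) ∈ D} :=
  Measure.map_apply (measurable_smul_coe_sphere r) hD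

theorem measurable_fiberMeasure (x : V) : Measurable (fiberMeasure hσ H x) := by
  refine Measure.measurable_of_measurable_coe _ fun D hD => ?_
  have h1 := stronglyMeasurable_opPow (-ContinuousLinearMap.adjoint H)
  have h2 : StronglyMeasurable fun r => opPow r (-ContinuousLinearMap.adjoint H) x :=
    (ContinuousLinearMap.apply ℂ V x).continuous.comp_stronglyMeasurable h1
  have hc : Continuous fun p : (V →L[ℂ] V) × V => (⟪p.2, p.1 p.2⟫_ℂ).re := by fun_prop
  have h3 := (hc.comp_stronglyMeasurable
    ((stronglyMeasurable_slice (σ := σ) hD).prodMk h2)).measurable.ennreal_ofReal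
  refine Eq.mpr (congrArg Measurable (funext fun r => ?_)) h3
  rw [fiberMeasure_apply hσ H x r hD, quadMeasure_apply hσ _ (measurableSet_slice hD r)]

/-- The scalar measure `⟨r^{-H} σ(dθ) r^{-H*} x, x⟩ dr / r` on `ℝᵈ`. -/
noncomputable def homogeneousMeasure (x : V) : Measure (EuclideanSpace ℝ (Fin d)) :=
  ((volume.restrict (Set.Ioi (0 : ℝ))).withDensity fun r => ENNReal.ofReal r⁻¹).bind
    (fiberMeasure hσ H x)

theorem lintegral_homogeneousMeasure (x : V) {f : EuclideanSpace ℝ (Fin d) → ℝ≥0∞}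
    (hf : Measurable f) : ∫⁻ u, f u ∂homogeneousMeasure hσ H x =
      ∫⁻ r in Set.Ioi (0 : ℝ), ENNReal.ofReal r⁻¹ * ∫⁻ u, f u ∂fiberMeasure hσ H x r := by
  have hm := measurable_fiberMeasure hσ H x
  unfold homogeneousMeasure
  rw [Measure.lintegral_bind hm.aemeasurable hf.aemeasurable,
    lintegral_withDensity_eq_lintegral_mul _ (by fun_prop)
      (g := fun r => ∫⁻ u, f u ∂fiberMeasure hσ H x r) ((Measure.measurable_lintegral hf).comp hm)]
  rfl

theorem homogeneousMeasure_apply (x : V) {D : Set (EuclideanSpace ℝ (Fin d))}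
    (hD : MeasurableSet D) : homogeneousMeasure hσ H x D =
      ∫⁻ r in Set.Ioi (0 : ℝ), ENNReal.ofReal r⁻¹ * fiberMeasure hσ H x r D := by
  rw [← lintegral_indicator_one hD, lintegral_homogeneousMeasure hσ H x (measurable_one.indicator hD)]
  simp only [lintegral_indicator_one hD]

theorem homogeneousMeasure_singleton_zero (x : V) : homogeneousMeasure hσ H x {0} = 0 := by
  rw [homogeneousMeasure_apply hσ H x (measurableSet_singleton 0)]
  refine setLIntegral_eq_zero measurableSet_Ioi fun r hr => ?_
  have : {θ : Metric.sphere (0 : EuclideanSpace ℝ (Fin d)) 1 |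
      r • (θ : EuclideanSpace ℝ (Fin d)) ∈ ({0} : Set (EuclideanSpace ℝ (Fin d)))} = ∅ := by
    ext θ
    simpa [(Set.mem_Ioi.1 hr).ne'] using ne_zero_of_mem_unit_sphere θ
  rw [fiberMeasure_apply hσ H x r (measurableSet_singleton 0), this]
  simp

/-- The measure `dr / r` is invariant under `r ↦ c r`, and `(c r)^{-H*} c^{H*} = r^{-H*}`. -/
theorem map_smul_homogeneousMeasure {c : ℝ} (hc : 0 < c) (x : V) :
    (homogeneousMeasure hσ H x).map (fun u => c • u) =
      homogeneousMeasure hσ H (opPow c (ContinuousLinearMap.adjoint H) x) := by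
  have hs : Measurable fun u : EuclideanSpace ℝ (Fin d) => c • u := measurable_const_smul c
  ext D hD
  rw [Measure.map_apply hs hD, homogeneousMeasure_apply hσ H _ (hs hD),
    homogeneousMeasure_apply hσ H _ hD, ← lintegral_Ioi_inv_mul_comp_mul hc
      (fun r => fiberMeasure hσ H (opPow c (ContinuousLinearMap.adjoint H) x) r D)
      ((Measure.measurable_coe hD).comp (measurable_fiberMeasure hσ H _))]
  refine setLIntegral_congr_fun measurableSet_Ioi fun r hr => ?_
  have h : opPow (c * r) (-ContinuousLinearMap.adjoint H)
      (opPow c (ContinuousLinearMap.adjoint H) x) =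
        opPow r (-ContinuousLinearMap.adjoint H) x := by
    rw [mul_comm, opPow_mul hr hc, ← mul_apply_eq_comp, mul_assoc, opPow_neg_mul_opPow, mul_one]
  simp only [fiberMeasure_apply hσ H _ _ hD, fiberMeasure_apply hσ H _ _ (hs hD), h]
  simp only [Set.mem_preimage, smul_smul]

theorem integrable_fourier_mul_conj_fourier {χ : VectorMeasure (EuclideanSpace ℝ (Fin d)) (V →L[ℂ] V)}
    (hT : IsTPlusMeasure χ) (n : ℕ) {l m : FinMeas d} (hl : l ∈ Lam d (n - 1))
    (hm : m ∈ Lam d (n - 1)) :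
    Integrable (fun u => fourier l u * conj (fourier m u) / ((min 1 (‖u‖ ^ (2 * n)) : ℝ) : ℂ))
      χ.variation := by
  refine Integrable.congr ?_ (.of_forall fun u => sum_sum_expRemainder hl hm u)
  refine integrable_finsetSum _ fun t _ => integrable_finsetSum _ fun s _ => Integrable.const_mul ?_ _
  exact integrable_variation hT (measurable_expRemainder _ _) (norm_expRemainder_le _ _)

variable {H} [TopologicalSpace.SeparableSpace V] {n : ℕ}
  (hfin : ∫⁻ r in Set.Ioi (0 : ℝ), traceNorm (polarIntegrand n H σ Set.univ r) < ∞)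

/-- The weight is constant, equal to `1 ∧ r ^ (2n)`, on the sphere of radius `r` carrying
`fiberMeasure`. -/
theorem quadMeasure_polarMeasure (hχ : ∀ s, MeasurableSet s → (polarMeasure n H hσ hfin s).IsPositive)
    (x : V) : quadMeasure hχ x = (homogeneousMeasure hσ H x).withDensity
      fun u => ENNReal.ofReal (min 1 (‖u‖ ^ (2 * n))) := by
  have hw : Measurable fun u : EuclideanSpace ℝ (Fin d) =>
    ENNReal.ofReal (min 1 (‖u‖ ^ (2 * n))) := by fun_prop
  ext D hD
  rw [quadMeasure_apply hχ x hD, polarMeasure_apply hσ hfin hD,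
    ofReal_re_inner_integral_polarIntegrand hσ hD (integrable_of_lintegral_traceNorm hσ hD
      (lintegral_traceNorm_polarIntegrand_lt_top hσ hfin hD)), withDensity_apply _ hD,
    ← lintegral_indicator hD, lintegral_homogeneousMeasure hσ H x (hw.indicator hD)]
  refine setLIntegral_congr_fun measurableSet_Ioi fun r hr => ?_
  have hr0 : (0 : ℝ) < r := hr
  have h : ∫⁻ u, D.indicator (fun u => ENNReal.ofReal (min 1 (‖u‖ ^ (2 * n)))) u
      ∂fiberMeasure hσ H x r = ENNReal.ofReal (min 1 (r ^ (2 * n))) *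
        fiberMeasure hσ H x r D := by
    rw [← lintegral_indicator_one hD, ← lintegral_const_mul _ (measurable_one.indicator hD)]
    unfold fiberMeasure
    rw [lintegral_map (hw.indicator hD) (measurable_smul_coe_sphere r),
      lintegral_map ((measurable_one.indicator hD).const_mul _) (measurable_smul_coe_sphere r)]
    refine lintegral_congr fun θ => ?_
    have hn : ‖r • (θ : EuclideanSpace ℝ (Fin d))‖ = r := by
      rw [norm_smul, norm_eq_of_mem_sphere, mul_one, Real.norm_of_nonneg hr0.le]
    by_cases hθ : r • (θ : EuclideanSpace ℝ (Fin d)) ∈ D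
    · simp only [Set.indicator_of_mem hθ, hn, Pi.one_apply, mul_one]
    · simp [hθ]
  rw [ofReal_re_inner_polarIntegrand hσ hD hr0, h, fiberMeasure_apply hσ H x r hD, ← mul_assoc,
    mul_comm, ENNReal.ofReal_mul (by positivity), mul_comm (ENNReal.ofReal r⁻¹), mul_comm]

/-- The weight cancels the denominator of `spectralCov` away from the origin, which is a null set.
What remains scales exactly under dilations. -/
theorem inner_spectralCov_polarMeasure {l m : FinMeas d} (hl : l ∈ Lam d (n - 1))
    (hm : m ∈ Lam d (n - 1)) (x : V) :
    ⟪x, spectralCov (polarMeasure n H hσ hfin) n l m x⟫_ℂ =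
      ∫ u, fourier l u * conj (fourier m u) ∂homogeneousMeasure hσ H x := by
  have hT := isTPlusMeasure_polarMeasure hσ hfin
  have hχ := fun s hs => (hT s hs).1
  unfold spectralCov
  rw [inner_opIntegral hχ (integrable_fourier_mul_conj_fourier hT n hl hm),
    quadMeasure_polarMeasure hσ hfin hχ,
    integral_withDensity_eq_integral_toReal_smul (by fun_prop) (.of_forall fun _ => by simp)]
  have h0 : ∀ᵐ u ∂homogeneousMeasure hσ H x, u ≠ 0 := by
    rw [ae_iff]
    simpa using homogeneousMeasure_singleton_zero hσ H x
  refine integral_congr_ae ?_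
  filter_upwards [h0] with u hu
  have h1 : (0 : ℝ) < min 1 (‖u‖ ^ (2 * n)) := by
    have := norm_pos_iff.2 hu
    positivity
  have h2 : ((min 1 (‖u‖ ^ (2 * n)) : ℝ) : ℂ) ≠ 0 := by exact_mod_cast h1.ne'
  rw [ENNReal.toReal_ofReal h1.le, Complex.real_smul, mul_div_cancel₀ _ h2]

theorem spectralCov_polarMeasure_dilate {c : ℝ} (hc : 0 < c) (l m : Lam d ((n : ℤ) - 1)) :
    spectralCov (polarMeasure n H hσ hfin) n (dilate c l).1 (dilate c m).1 =
      opPow c H * spectralCov (polarMeasure n H hσ hfin) n l.1 m.1 *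
        ContinuousLinearMap.adjoint (opPow c H) := by
  refine ext_quadratic fun x => ?_
  rw [inner_spectralCov_polarMeasure hσ hfin (dilate c l).2 (dilate c m).2, mul_apply_eq_comp,
    mul_apply_eq_comp, ← ContinuousLinearMap.adjoint_inner_left,
    inner_spectralCov_polarMeasure hσ hfin l.2 m.2, adjoint_opPow,
    ← map_smul_homogeneousMeasure hσ H hc, integral_map (measurable_const_smul c).aemeasurable]
  · simp only [fourier_dilate]
  · have := continuous_fourier l.1
    have := continuous_fourier m.1
    exact Continuous.aestronglyMeasurable (by fun_prop)

theorem isCovSelfSimilar_of_crossCov_eq [MeasurableSpace V] {Ω : Type*} [MeasurableSpace Ω]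
    {P : Measure Ω} {Y : Lam d ((n : ℤ) - 1) →ₗ[ℂ] (Ω → V)}
    (hi : ∀ l m, Integrable (fun ω => InnerProductSpace.rankOne ℂ (Y l ω) (Y m ω)) P)
    (hY : ∀ l m, crossCov P (Y l) (Y m) = spectralCov (polarMeasure n H hσ hfin) n l.1 m.1) :
    IsCovSelfSimilar P Y H := by
  intro c hc l m
  rw [hY, spectralCov_polarMeasure_dilate hσ hfin hc, ← hY]
  exact (crossCov_map _ (hi l m)).symm

end Homogeneous

/-! ### Finiteness of the radial trace integral is necessary. -/

section Necessity

variable {V : Type*} [NormedAddCommGroup V] [InnerProductSpace ℂ V] [CompleteSpace V]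
  [TopologicalSpace.SeparableSpace V] {d : ℕ}
  {σ : VectorMeasure (Metric.sphere (0 : EuclideanSpace ℝ (Fin d)) 1) (V →L[ℂ] V)}
  {H : V →L[ℂ] V} {n : ℕ}

/-- The polar form only speaks of sets away from `0`, so `ℝᵈ ∖ {0}` is exhausted by `{‖u‖ ≥
1/(i+1)}`; the traces of `χ` there are bounded by the trace of its total mass. -/
theorem lintegral_traceNorm_polarIntegrand_of_hasPolarForm
    (hσ : ∀ s, MeasurableSet s → (σ s).IsPositive)
    {χ : VectorMeasure (EuclideanSpace ℝ (Fin d)) (V →L[ℂ] V)} (hT : IsTPlusMeasure χ)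
    (h : HasPolarForm (n - 1) H σ χ) :
    ∫⁻ r in Set.Ioi (0 : ℝ), traceNorm (polarIntegrand n H σ Set.univ r) < ∞ := by
  obtain ⟨w, b, -⟩ := exists_hilbertBasis ℂ V
  have hχ := fun s hs => (hT s hs).1
  refine lt_of_le_of_lt ?_ (hT _ .univ).2
  let s : ℕ → Set ℝ := fun i => Set.Ici (1 / ((i : ℝ) + 1))
  have hs : ∀ i, MeasurableSet (s i) := fun i => measurableSet_Ici
  have hmono : Monotone s := fun i j hij =>
    Set.Ici_subset_Ici.2 (Nat.one_div_le_one_div hij)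
  have hU : ⋃ i, s i = Set.Ioi 0 := by
    ext r
    simp only [Set.mem_iUnion, Set.mem_Ioi, s, Set.mem_Ici]
    exact ⟨fun ⟨i, hi⟩ => Nat.one_div_pos_of_nat.trans_le hi, fun hr =>
      (exists_nat_one_div_lt hr).imp fun _ => le_of_lt⟩
  rw [← hU, setLIntegral_iUnion_of_directed _ hmono.directed_le]
  refine iSup_le fun i => ?_
  have hpos : (0 : ℝ) < 1 / ((i : ℝ) + 1) := Nat.one_div_pos_of_nat
  let D : Set (EuclideanSpace ℝ (Fin d)) := {u | 1 / ((i : ℝ) + 1) ≤ ‖u‖}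
  have hD : MeasurableSet D := measurableSet_le measurable_const measurable_norm
  obtain ⟨hm, hlt, he⟩ := hasPolarForm_iff.1 h D hD ⟨_, hpos, fun u hu => hu⟩
  -- For `r ≥ 1/(i+1)` the slice of `D` is the whole sphere.
  have h1 : ∫⁻ r in s i, traceNorm (polarIntegrand n H σ Set.univ r) ≤
      ∫⁻ r in s i, traceNorm (polarIntegrand n H σ D r) := by
    refine (setLIntegral_congr_fun (hs i) fun r hr => ?_).le
    have hr' : 1 / ((i : ℝ) + 1) ≤ r := hr
    have : {θ : Metric.sphere (0 : EuclideanSpace ℝ (Fin d)) 1 |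
        r • (θ : EuclideanSpace ℝ (Fin d)) ∈ D} = Set.univ := by
      ext θ
      have hn : ‖r • (θ : EuclideanSpace ℝ (Fin d))‖ = r := by
        rw [norm_smul, norm_eq_of_mem_sphere, mul_one, Real.norm_of_nonneg (hpos.le.trans hr')]
      simpa only [Set.mem_ofPred_eq, Set.mem_univ, iff_true, D, hn] using hr'
    simp only [polarIntegrand, this, Set.mem_univ, Set.ofPred_true]
  have h2 : s i ⊆ Set.Ioi 0 := fun r hr => hpos.trans_le hr
  refine h1.trans ((lintegral_mono_set h2).trans ?_)
  rw [← traceNorm_integral_polarIntegrand hσ hD (integrable_of_lintegral_traceNorm hσ hD hlt), ← he,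
    traceNorm_of_isPositive b (hχ _ hD), traceNorm_of_isPositive b (hχ _ .univ)]
  refine ENNReal.tsum_le_tsum fun j => ?_
  rw [← quadMeasure_apply hχ _ hD, ← quadMeasure_apply hχ _ .univ]
  exact measure_mono (Set.subset_univ _)

end Necessity

/-! ### The characterization and the main theorem. -/

section Characterization

variable {V : Type*} [NormedAddCommGroup V] [InnerProductSpace ℂ V] [CompleteSpace V]
  [TopologicalSpace.SeparableSpace V] {d : ℕ}
  {σ : VectorMeasure (Metric.sphere (0 : EuclideanSpace ℝ (Fin d)) 1) (V →L[ℂ] V)}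
  {H : V →L[ℂ] V}

theorem lintegral_traceNorm_polarIntegrand_lt_top_iff (n : ℕ)
    (hσ : ∀ s, MeasurableSet s → (σ s).IsPositive)
    {ι : Type*} {e : HilbertBasis ι ℂ V} {lam : ι → ℂ} (hH : IsNormalDiagonal H e lam) :
    ∫⁻ r in Set.Ioi (0 : ℝ), traceNorm (polarIntegrand n H σ Set.univ r) < ∞ ↔
      (∀ j, 0 < (⟪e j, σ Set.univ (e j)⟫_ℂ).re → 0 < (lam j).re ∧ (lam j).re < n) ∧
        Summable fun j => (1 / (n - (lam j).re) + 1 / (lam j).re) *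
          (⟪e j, σ Set.univ (e j)⟫_ℂ).re := by
  rw [lintegral_traceNorm_polarIntegrand_univ hσ hH, lt_top_iff_ne_top]
  exact tsum_radialIntegral_ne_top_iff n fun j =>
    re_inner_nonneg_of_isPositive (hσ _ .univ) (e j)

theorem existsSelfSimilarIRF_polarMeasure [MeasurableSpace V] {n : ℕ}
    (hσ : ∀ s, MeasurableSet s → (σ s).IsPositive)
    (hfin : ∫⁻ r in Set.Ioi (0 : ℝ), traceNorm (polarIntegrand n H σ Set.univ r) < ∞) :
    ExistsSelfSimilarIRF.{_, w} (n - 1) H (polarMeasure n H hσ hfin) 0 := by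
  obtain ⟨Ω, mΩ, P, Y, hP, hY, hc, hs, hi, hcov⟩ := exists_irf_of_isTPlusMeasure.{w}
    (isTPlusMeasure_polarMeasure hσ hfin) (polarMeasure_singleton_zero hσ hfin) n
  exact ⟨Ω, mΩ, P, Y, hP, hY, hc, isCovSelfSimilar_of_crossCov_eq hσ hfin hi hcov, hs⟩

end Characterization

end SelfSimilarIRF

theorem mainTheorem8 {V : Type u} [NormedAddCommGroup V] [InnerProductSpace ℂ V]
    [CompleteSpace V] [TopologicalSpace.SeparableSpace V] [MeasurableSpace V] [BorelSpace V]
    (d : ℕ) (hd : 1 ≤ d) (k : ℤ) (hk : -1 ≤ k)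
    {ι : Type v} (e : HilbertBasis ι ℂ V) (lam : ι → ℂ) (H : V →L[ℂ] V)
    (hH : IsNormalDiagonal H e lam)
    (σ : VectorMeasure (Metric.sphere (0 : EuclideanSpace ℝ (Fin d)) 1) (V →L[ℂ] V))
    (hσ : IsTPlusMeasure σ) :
    ((∃ χ, HasPolarForm k H σ χ ∧ ∃ Q, ExistsSelfSimilarIRF.{u, w} k H χ Q) ↔
      ((∀ j, 0 < (⟪e j, σ Set.univ (e j)⟫_ℂ).re → 0 < (lam j).re ∧ (lam j).re < k + 1) ∧
        Summable fun j => (1 / (k + 1 - (lam j).re) + 1 / (lam j).re) *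
          (⟪e j, σ Set.univ (e j)⟫_ℂ).re)) ∧
    ((∃ χ, HasPolarForm k H σ χ ∧ ExistsSelfSimilarIRF.{u, w} k H χ 0) ↔
      ((∀ j, 0 < (⟪e j, σ Set.univ (e j)⟫_ℂ).re → 0 < (lam j).re ∧ (lam j).re < k + 1) ∧
        Summable fun j => (1 / (k + 1 - (lam j).re) + 1 / (lam j).re) *
          (⟪e j, σ Set.univ (e j)⟫_ℂ).re)) := by
  -- With `n = k + 1` all exponents are natural numbers, and `k = -1` becomes `n = 0`.
  obtain ⟨n, rfl⟩ : ∃ n : ℕ, k = n - 1 := ⟨(k + 1).toNat, by omega⟩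
  have hpos := fun s hs => (hσ s hs).1
  have hn : (((n : ℤ) - 1 : ℤ) : ℝ) + 1 = n := by push_cast; ring
  rw [hn, ← lintegral_traceNorm_polarIntegrand_lt_top_iff n hpos hH]
  have hsuff : (∫⁻ r in Set.Ioi (0 : ℝ), traceNorm (polarIntegrand n H σ Set.univ r) < ∞) →
      ∃ χ, HasPolarForm (n - 1) H σ χ ∧ ExistsSelfSimilarIRF.{u, w} (n - 1) H χ 0 := fun hfin =>
    ⟨polarMeasure n H hpos hfin, hasPolarForm_polarMeasure hpos hfin,
      existsSelfSimilarIRF_polarMeasure.{w} hpos hfin⟩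
  -- From the process only the fact that `χ` is a finite positive trace-class measure is kept, so
  -- `Q` may be arbitrary.
  have hnec : ∀ χ Q, HasPolarForm (n - 1) H σ χ → ExistsSelfSimilarIRF.{u, w} (n - 1) H χ Q →
      ∫⁻ r in Set.Ioi (0 : ℝ), traceNorm (polarIntegrand n H σ Set.univ r) < ∞ :=
    fun χ Q hχ ⟨_, _, _, _, _, _, _, _, hs⟩ =>
      lintegral_traceNorm_polarIntegrand_of_hasPolarForm hpos hs.1 hχ
  exact ⟨⟨fun ⟨χ, hχ, Q, hQ⟩ => hnec χ Q hχ hQ,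
      fun hfin => (hsuff hfin).imp fun _ h => ⟨h.1, 0, h.2⟩⟩,
    fun ⟨χ, hχ, h0⟩ => hnec χ 0 hχ h0, hsuff⟩
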